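/- For a set $I$, a polyadic algebra of dimension $I$ is a Boolean algebra with operators $\mathsf c_{(J)}$ ($J\subseteq I$) and $\mathsf s_\tau$ ($\tau: I\to I$) satisfying Halmos' axioms; a polyadic equality algebra has in addition diagonal elements $\mathsf d_{ij}$ ($i,j\in I$). $\mathsf{PA}_n,\mathsf{PEA}_n$ ($n<\omega$) and $\mathsf{PA}_\omega,\mathsf{PEA}_\omega$ are the classes of these algebras of dimension $n$ and $\omega$. For $n\le m\le\omega$ and an algebra $\mathfrak C$ of dimension $m$, the neat reduct $\mathfrak{Nr}_n\mathfrak C$ has universe $\{x\in C:\mathsf c_{(m\setminus n)}x=x\}$ and the operations of $\mathfrak C$ indexed in dimension $n$ (a transformation of $n$ being extended to $m$ by the identity); $\mathsf{Nr}_n\mathsf K$ is the class of algebras isomorphic to $\mathfrak{Nr}_n\mathfrak C$ for some $\mathfrak C\in\mathsf K$. The atom structure $\mathrm{At}\,\mathfrak A$ is the set of atoms of $\mathfrak A$ with the relations $a\le \mathsf c_{(J)}b$, $a\le\mathsf s_\tau b$ and $a\le\mathsf d_{ij}$. In the game $EF_\omega(\mathfrak A,\mathfrak B)$ two players, $\forall$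 and $\exists$, play $\omega$ rounds; in round $k$ player $\forall$ chooses an atom of one of the two algebras, and $\exists$ answers with an atom of the other, so that an atom $a_k$ of $\mathfrak A$ and an atom $b_k$ of $\mathfrak B$ are chosen. Player $\exists$ wins if there is an isomorphism from the subalgebra of $\mathfrak A$ generated by $\{a_k:k<\omega\}$ onto the subalgebra of $\mathfrak B$ generated by $\{b_k:k<\omega\}$ that maps $a_k$ to $b_k$ for all $k$. Theorem. For every finite $n>1$ there are atomic polyadic equality algebras $\mathfrak A=\mathfrak A(n)$ and $\mathfrak B=\mathfrak B(n)$ of dimension $n$ such that: 1. $\mathfrak A$ is uncountable and isomorphic to an algebra of $n$-ary relations on an uncountable set $U$, that is, to a subalgebra of the full polyadic equality set algebra $\wp({}^nU)$; 2. $\mathfrak A\in\mathsf{Nr}_n\mathsf{PEA}_\omega$, and the diagonal-free reduct of $\mathfrak A$ is in $\mathsf{Nr}_n\mathsf{PA}_\omega$; 3. the diagonal-free reduct of $\mathfrak B$ is not in $\mathsf{Nr}_n\mathsf{PA}_{n+1}$; 4. $\exists$ has a winning strategy in $EF_\omega(\mathfrak A,\mathfrak B)$; 5. $\mathfrak A\equiv_{\infty,\omega}\mathfrak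 B$, and $\mathrm{At}\,\mathfrak A\equiv_{\infty,\omega}\mathrm{At}\,\mathfrak B$. -/

import Mathlib

open scoped FirstOrder

universe u v w

/-! ### Polyadic algebras and polyadic equality algebras -/

/-- A polyadic algebra (in the sense of Halmos) of dimension `ι` on a Boolean algebra `A`:
a cylindrification `cyl J` for every set `J` of indices and a substitution `sub τ` for every
transformation `τ` of the index set. For finite `ι` this is `PA_n`, for `ι = ℕ` it is `PA_ω`. -/
class PolyadicAlgebra (ι : Type u) (A : Type v) [BooleanAlgebra A] where
  cyl : Set ι → A → A
  sub : (ι → ι) → A → A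
  cyl_bot : ∀ J, cyl J ⊥ = ⊥
  le_cyl : ∀ J x, x ≤ cyl J x
  cyl_inf_cyl : ∀ J x y, cyl J (x ⊓ cyl J y) = cyl J x ⊓ cyl J y
  cyl_empty : ∀ x, cyl ∅ x = x
  cyl_cyl : ∀ J K x, cyl J (cyl K x) = cyl (J ∪ K) x
  sub_sup : ∀ τ x y, sub τ (x ⊔ y) = sub τ x ⊔ sub τ y
  sub_compl : ∀ τ x, sub τ xᶜ = (sub τ x)ᶜ
  sub_id : ∀ x, sub id x = x
  sub_sub : ∀ σ τ x, sub σ (sub τ x) = sub (σ ∘ τ) x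
  sub_cyl_congr : ∀ (σ τ : ι → ι) (J : Set ι) (x : A), (∀ i ∉ J, σ i = τ i) →
    sub σ (cyl J x) = sub τ (cyl J x)
  cyl_sub : ∀ (τ : ι → ι) (J : Set ι) (x : A), Set.InjOn τ (τ ⁻¹' J) →
    cyl J (sub τ x) = sub τ (cyl (τ ⁻¹' J) x)

open Classical in
/-- A polyadic equality algebra of dimension `ι`: a polyadic algebra with diagonal elements.
`Function.update id i j` is the replacement sending `i` to `j` and fixing everything else. -/
class PolyadicEqualityAlgebra (ι : Type u) (A : Type v) [BooleanAlgebra A] extends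
    PolyadicAlgebra ι A where
  diag : ι → ι → A
  diag_self : ∀ i, diag i i = ⊤
  inf_diag_le : ∀ i j x, x ⊓ diag i j ≤ sub (Function.update id i j) x
  sub_diag : ∀ τ i j, sub τ (diag i j) = diag (τ i) (τ j)

open Classical in
/-- The full polyadic equality set algebra of dimension `ι` with base `U`. -/
instance fullSetAlgebra (ι : Type u) (U : Type v) :
    PolyadicEqualityAlgebra ι (Set (ι → U)) where
  cyl J X := {s | ∃ t ∈ X, ∀ i ∉ J, s i = t i}
  sub τ X := {s | s ∘ τ ∈ X}
  diag i j := {s | s i = s j}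
  cyl_bot J := by ext s; simp
  le_cyl J X := fun s hs => ⟨s, hs, fun _ _ => rfl⟩
  cyl_inf_cyl J X Y := by
    ext s
    constructor
    · rintro ⟨t, ⟨ht, r, hr, htr⟩, hst⟩
      exact ⟨⟨t, ht, hst⟩, r, hr, fun i hi => (hst i hi).trans (htr i hi)⟩
    · rintro ⟨⟨t, ht, hst⟩, r, hr, hsr⟩
      exact ⟨t, ⟨ht, r, hr, fun i hi => (hst i hi).symm.trans (hsr i hi)⟩, hst⟩
  cyl_empty X := by
    ext s
    constructor
    · rintro ⟨t, ht, h⟩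
      have : s = t := funext fun i => h i (Set.notMem_empty i)
      exact this ▸ ht
    · exact fun hs => ⟨s, hs, fun _ _ => rfl⟩
  cyl_cyl J K X := by
    ext s
    constructor
    · rintro ⟨t, ⟨r, hr, htr⟩, hst⟩
      exact ⟨r, hr, fun i hi => (hst i fun h => hi (Or.inl h)).trans
        (htr i fun h => hi (Or.inr h))⟩
    · rintro ⟨r, hr, hsr⟩
      refine ⟨fun i => if i ∈ J then r i else s i, ⟨r, hr, fun i hi => ?_⟩, fun i hi => ?_⟩
      · by_cases h : i ∈ J
        · simp [h]
        · simpa [h] using hsr i (fun h' => h'.elim h hi)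
      · simp [hi]
  sub_sup τ X Y := rfl
  sub_compl τ X := rfl
  sub_id X := rfl
  sub_sub σ τ X := rfl
  sub_cyl_congr σ τ J X h := by
    ext s
    constructor
    · rintro ⟨t, ht, hst⟩
      exact ⟨t, ht, fun i hi => (congrArg s (h i hi)).symm.trans (hst i hi)⟩
    · rintro ⟨t, ht, hst⟩
      exact ⟨t, ht, fun i hi => (congrArg s (h i hi)).trans (hst i hi)⟩
  cyl_sub τ J X h := by
    ext s
    constructor
    · rintro ⟨t, ht, hst⟩
      exact ⟨t ∘ τ, ht, fun i hi => hst (τ i) hi⟩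
    · rintro ⟨r, hr, hsr⟩
      refine ⟨fun k => if hk : ∃ i, τ i ∈ J ∧ τ i = k then r hk.choose else s k, ?_, ?_⟩
      · have : (fun k => if hk : ∃ i, τ i ∈ J ∧ τ i = k then r hk.choose else s k) ∘ τ = r := by
          funext i
          by_cases hi : τ i ∈ J
          · have hk : ∃ i', τ i' ∈ J ∧ τ i' = τ i := ⟨i, hi, rfl⟩
            have he : hk.choose = i := h hk.choose_spec.1 hi hk.choose_spec.2
            simp only [Function.comp_apply, dif_pos hk, he]
          · have hk : ¬ ∃ i', τ i' ∈ J ∧ τ i' = τ i := by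
              rintro ⟨i', h1, h2⟩
              exact hi (h2 ▸ h1)
            simp only [Function.comp_apply, dif_neg hk]
            exact hsr i hi
        show _ ∘ τ ∈ X
        rw [this]
        exact hr
      · intro k hk
        have : ¬ ∃ i, τ i ∈ J ∧ τ i = k := by
          rintro ⟨i, h1, h2⟩
          exact hk (h2 ▸ h1)
        simp only [dif_neg this]
  diag_self i := by ext s; simp
  inf_diag_le i j X := by
    rintro s ⟨hs, hd⟩
    have : s ∘ Function.update id i j = s := by
      funext k
      by_cases hk : k = i
      · subst hk
        simpa using (show s k = s j from hd).symm
      · simp [hk]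
    show s ∘ Function.update id i j ∈ X
    rw [this]
    exact hs
  sub_diag τ i j := rfl

/-! ### Signatures of polyadic equality algebras and of their atom structures -/

/-- Operation symbols of polyadic equality algebras of dimension `ι`. -/
inductive PEAFunctions (ι : Type u) : ℕ → Type u
  | bot : PEAFunctions ι 0
  | top : PEAFunctions ι 0
  | diag (i j : ι) : PEAFunctions ι 0
  | compl : PEAFunctions ι 1
  | cyl (J : Set ι) : PEAFunctions ι 1
  | sub (τ : ι → ι) : PEAFunctions ι 1
  | inf : PEAFunctions ι 2
  | sup : PEAFunctions ι 2

/-- The (purely functional) signature of polyadic equality algebras of dimension `ι`. -/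
def peaLanguage (ι : Type u) : FirstOrder.Language.{u, 0} :=
  ⟨PEAFunctions ι, fun _ => Empty⟩

/-- A polyadic equality algebra as a structure for its signature. -/
instance peaStructure (ι : Type u) (A : Type v) [BooleanAlgebra A]
    [PolyadicEqualityAlgebra ι A] : (peaLanguage ι).Structure A where
  funMap {k} (F : PEAFunctions ι k) :=
    match k, F with
    | _, .bot => fun _ => ⊥
    | _, .top => fun _ => ⊤
    | _, .diag i j => fun _ => PolyadicEqualityAlgebra.diag i j
    | _, .compl => fun x => (x 0)ᶜ
    | _, .cyl J => fun x => PolyadicAlgebra.cyl J (x 0)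
    | _, .sub τ => fun x => PolyadicAlgebra.sub τ (x 0)
    | _, .inf => fun x => x 0 ⊓ x 1
    | _, .sup => fun x => x 0 ⊔ x 1
  RelMap R := R.elim

/-- Relation symbols of atom structures of dimension `ι`. -/
inductive AtomRelations (ι : Type u) : ℕ → Type u
  | diag (i j : ι) : AtomRelations ι 1
  | cyl (J : Set ι) : AtomRelations ι 2
  | sub (τ : ι → ι) : AtomRelations ι 2

/-- The (purely relational) signature of atom structures of dimension `ι`. -/
def atomLanguage (ι : Type u) : FirstOrder.Language.{0, u} :=
  ⟨fun _ => Empty, AtomRelations ι⟩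

/-- The set `At A` of atoms of a Boolean algebra. -/
abbrev Atoms (A : Type v) [BooleanAlgebra A] : Type v := {a : A // IsAtom a}

/-- The atom structure of a polyadic equality algebra: an operation `f` induces the relation
`a ≤ f b`, and a constant `d` induces the predicate `a ≤ d`. -/
instance atomStructure (ι : Type u) (A : Type v) [BooleanAlgebra A]
    [PolyadicEqualityAlgebra ι A] : (atomLanguage ι).Structure (Atoms A) where
  funMap F := F.elim
  RelMap {k} (R : AtomRelations ι k) :=
    match k, R with
    | _, .diag i j => fun x => (x 0 : A) ≤ PolyadicEqualityAlgebra.diag i j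
    | _, .cyl J => fun x => (x 0 : A) ≤ PolyadicAlgebra.cyl J (x 1 : A)
    | _, .sub τ => fun x => (x 0 : A) ≤ PolyadicAlgebra.sub τ (x 1 : A)

/-! ### The logic `L_{∞,ω}` -/

/-- Formulas of `L_{∞,ω}` in the signature `L` with free variables among `x_0, …, x_{k-1}`:
conjunctions over arbitrary index sets, quantification over single variables. -/
inductive InfFormula (L : FirstOrder.Language.{0, 0}) : ℕ → Type 1
  | equal {k : ℕ} (s t : L.Term (Fin k)) : InfFormula L k
  | rel {k l : ℕ} (R : L.Relations l) (ts : Fin l → L.Term (Fin k)) : InfFormula L k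
  | not {k : ℕ} (φ : InfFormula L k) : InfFormula L k
  | conj {k : ℕ} {I : Type} (φ : I → InfFormula L k) : InfFormula L k
  | all {k : ℕ} (φ : InfFormula L (k + 1)) : InfFormula L k

/-- Satisfaction of an `L_{∞,ω}` formula under an assignment of its free variables. -/
def InfFormula.Realize {L : FirstOrder.Language.{0, 0}} (M : Type v) [L.Structure M] :
    {k : ℕ} → InfFormula L k → (Fin k → M) → Prop
  | _, .equal s t, x => s.realize x = t.realize x
  | _, .rel R ts, x => FirstOrder.Language.Structure.RelMap R fun i => (ts i).realize x
  | _, .not φ, x => ¬ φ.Realize M x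
  | _, .conj φ, x => ∀ i, (φ i).Realize M x
  | _, .all φ, x => ∀ a : M, φ.Realize M (Fin.snoc x a)

/-- `M ≡_{∞,ω} N`: the two structures satisfy the same `L_{∞,ω}` sentences. -/
def InfEquiv (L : FirstOrder.Language.{0, 0}) (M : Type v) (N : Type w) [L.Structure M] [L.Structure N] :
    Prop :=
  ∀ φ : InfFormula L 0, φ.Realize M Fin.elim0 ↔ φ.Realize N Fin.elim0

/-! ### The Ehrenfeucht–Fraïssé game of length `ω` on atoms -/

/-- A strategy for the second player: after `k` rounds, in which the pairs `h 0, …, h (k-1)` of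
atoms were played, it answers an atom of `A` by an atom of `B` and an atom of `B` by an atom
of `A`. -/
structure AtomGameStrategy (A : Type v) (B : Type w) [BooleanAlgebra A] [BooleanAlgebra B] where
  answerInB : (k : ℕ) → (Fin k → Atoms A × Atoms B) → Atoms A → Atoms B
  answerInA : (k : ℕ) → (Fin k → Atoms A × Atoms B) → Atoms B → Atoms A

/-- The play `p` (of length `ω`) is one in which the second player uses the strategy `S`; in
every round the first player has chosen an atom of `A` or an atom of `B`. -/
def AtomGameStrategy.Follows {A : Type v} {B : Type w} [BooleanAlgebra A] [BooleanAlgebra B]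
    (S : AtomGameStrategy A B) (p : ℕ → Atoms A × Atoms B) : Prop :=
  ∀ k : ℕ, (p k).2 = S.answerInB k (fun i => p i) (p k).1 ∨
    (p k).1 = S.answerInA k (fun i => p i) (p k).2

/-- The second player wins the play `p = (a, b)`: there is an isomorphism from the subalgebra
of `A` generated by the range of `a` onto the subalgebra of `B` generated by the range of `b`
that maps `a k` to `b k` for every `k`. -/
def AtomGameWon (ι : Type u) {A : Type v} {B : Type w} [BooleanAlgebra A] [BooleanAlgebra B]
    [PolyadicEqualityAlgebra ι A] [PolyadicEqualityAlgebra ι B]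
    (p : ℕ → Atoms A × Atoms B) : Prop :=
  ∃ f : FirstOrder.Language.Substructure.closure (peaLanguage ι) (Set.range fun k => ((p k).1 : A))
      ≃[peaLanguage ι]
      FirstOrder.Language.Substructure.closure (peaLanguage ι) (Set.range fun k => ((p k).2 : B)),
    ∀ k : ℕ, (f ⟨(p k).1, FirstOrder.Language.Substructure.subset_closure ⟨k, rfl⟩⟩ : B) = (p k).2

/-- The second player has a winning strategy in the game `EF_ω(A, B)`. -/
def HasWinningStrategy (ι : Type u) (A : Type v) (B : Type w)
    [BooleanAlgebra A] [BooleanAlgebra B]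
    [PolyadicEqualityAlgebra ι A] [PolyadicEqualityAlgebra ι B] : Prop :=
  ∃ S : AtomGameStrategy A B, ∀ p, S.Follows p → AtomGameWon ι p

/-! ### Neat reducts -/

/-- For `e : ι ↪ κ`, the map `f` is an isomorphism of the polyadic algebra `A` of dimension `ι`
onto the neat `ι`-reduct of the polyadic algebra `C` of dimension `κ`. The neat reduct consists
of the elements of `C` supported by (the image of) `ι`; a transformation of `ι` acts on `C`
through its extension to `κ` by the identity. -/
structure IsNeatReductIso {ι κ : Type} (e : ι ↪ κ) {A : Type v} {C : Type w}
    [BooleanAlgebra A] [PolyadicAlgebra ι A] [BooleanAlgebra C] [PolyadicAlgebra κ C]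
    (f : A → C) : Prop where
  injective : Function.Injective f
  range_eq : Set.range f = {x | PolyadicAlgebra.cyl (Set.range e)ᶜ x = x}
  map_sup : ∀ x y, f (x ⊔ y) = f x ⊔ f y
  map_compl : ∀ x, f xᶜ = (f x)ᶜ
  map_cyl : ∀ (J : Set ι) x, f (PolyadicAlgebra.cyl J x) = PolyadicAlgebra.cyl (e '' J) (f x)
  map_sub : ∀ (τ : ι → ι) x, f (PolyadicAlgebra.sub τ x) =
    PolyadicAlgebra.sub (Function.extend e (e ∘ τ) id) (f x)

/-- `A ∈ Nr_ι PA_κ`: `A` is, up to isomorphism, the neat `ι`-reduct of a polyadic algebra of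
dimension `κ`. If `A` is an equality algebra, its diagonal elements are disregarded. -/
def InNrPA {ι κ : Type} (e : ι ↪ κ) (A : Type v) [BooleanAlgebra A] [PolyadicAlgebra ι A] :
    Prop :=
  ∃ (C : Type u) (_ : BooleanAlgebra C) (_ : PolyadicAlgebra κ C) (f : A → C),
    IsNeatReductIso e f

/-- `A ∈ Nr_ι PEA_κ`: `A` is, up to isomorphism (preserving the diagonal elements as well), the
neat `ι`-reduct of a polyadic equality algebra of dimension `κ`. -/
def InNrPEA {ι κ : Type} (e : ι ↪ κ) (A : Type v) [BooleanAlgebra A]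
    [PolyadicEqualityAlgebra ι A] : Prop :=
  ∃ (C : Type u) (_ : BooleanAlgebra C) (_ : PolyadicEqualityAlgebra κ C) (f : A → C),
    IsNeatReductIso e f ∧
    ∀ i j : ι, f (PolyadicEqualityAlgebra.diag i j) = PolyadicEqualityAlgebra.diag (e i) (e j)

/-! ### Subalgebras of full polyadic equality set algebras -/

/-! Write n = m + 2. The base is a generic set of points of two sorts: each point x and m-tuple w of
parameters have a value `Point.val x w`, consisting of a block index and a colour in a group of
exponent two, and over any finite set of points a new point can be added with all its values
prescribed (`Point.exists_val_eq`). For two points outside m distinct parameters one looks at their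
blocks and, if these coincide, at the sum of their colours, which is also their difference. If the
sorts differ, this difference is seen only through a surjection π onto a set S of cross colours. A
relation belongs to the algebra when finitely many block indices, finitely many differences within a
sort and finitely many cross colours decide membership. The algebra A has π = id, so uncountably
many cross colours; B has S = ℕ.

An n-tuple has room for only two points besides m distinct parameters, hence for a single
difference, and addition of colours cannot be observed. So every finite injective matching between
the cross colours of A and those of B preserves cylindrifications (`ColorMatched.extends_one`,
`Matched.exists_forth`, `Corr.cyl`). Such matchings form a back-and-forth system
(`backAndForth_corrSystem`), which yields the winning strategy and both `L_{∞,ω}`-equivalences.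

When π = id, the finitely many colours of a support generate a finite subgroup. Matching all colours
of a subgroup respects addition, so it can be extended over any number of points
(`ColorMatched.extends_subgroup`). Hence the relations of arity ω that depend on finitely many
places and are finitely supported form an algebra whose neat n-reduct is A
(`isNeatReductIso_neatMap`).

In a neat reduct of an algebra of dimension n + 1 relations can be composed, the additional place
serving as middle point. Suppose B were such a neat reduct. The composition of `same sort,
difference g` with a fixed cross colour still forces equality of blocks. Equality of blocks is
visible only through colours in the support, so the composition meets one cross colour c(g) in
infinitely many blocks. There are uncountably many g and countably many cross colours, so some d
equals c(g) for infinitely many g. Turning the triangle around, the composition of d with the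
converse of the fixed cross colour meets difference g in infinitely many blocks for each of these g,
although its support contains only finitely many differences (`not_inNrPA_supportedAlgebra`). -/

/-- A polyadic equality set algebra: a subalgebra of the full algebra of relations on `U`. -/
structure SetPEA (ι : Type u) (U : Type v) extends BooleanSubalgebra (Set (ι → U)) where
  cyl_mem : ∀ (J : Set ι) X, X ∈ carrier → PolyadicAlgebra.cyl J X ∈ carrier
  sub_mem : ∀ (τ : ι → ι) X, X ∈ carrier → PolyadicAlgebra.sub τ X ∈ carrier
  diag_mem : ∀ i j : ι, PolyadicEqualityAlgebra.diag i j ∈ carrier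

namespace SetPEA

variable {ι : Type u} {U : Type v}

/-- The universe of a polyadic equality set algebra. -/
abbrev Carrier (S : SetPEA ι U) : Type (max u v) := S.toBooleanSubalgebra

instance (S : SetPEA ι U) : PolyadicEqualityAlgebra ι S.Carrier where
  cyl J X := ⟨PolyadicAlgebra.cyl J X.1, S.cyl_mem J _ X.2⟩
  sub τ X := ⟨PolyadicAlgebra.sub τ X.1, S.sub_mem τ _ X.2⟩
  diag i j := ⟨PolyadicEqualityAlgebra.diag i j, S.diag_mem i j⟩
  cyl_bot J := Subtype.ext (PolyadicAlgebra.cyl_bot J)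
  le_cyl J X := PolyadicAlgebra.le_cyl J X.1
  cyl_inf_cyl J X Y := Subtype.ext (PolyadicAlgebra.cyl_inf_cyl J X.1 Y.1)
  cyl_empty X := Subtype.ext (PolyadicAlgebra.cyl_empty X.1)
  cyl_cyl J K X := Subtype.ext (PolyadicAlgebra.cyl_cyl J K X.1)
  sub_sup τ X Y := Subtype.ext (PolyadicAlgebra.sub_sup τ X.1 Y.1)
  sub_compl τ X := Subtype.ext (PolyadicAlgebra.sub_compl τ X.1)
  sub_id X := Subtype.ext (PolyadicAlgebra.sub_id X.1)
  sub_sub σ τ X := Subtype.ext (PolyadicAlgebra.sub_sub σ τ X.1)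
  sub_cyl_congr σ τ J X h := Subtype.ext (PolyadicAlgebra.sub_cyl_congr σ τ J X.1 h)
  cyl_sub τ J X h := Subtype.ext (PolyadicAlgebra.cyl_sub τ J X.1 h)
  diag_self i := Subtype.ext (PolyadicEqualityAlgebra.diag_self i)
  inf_diag_le i j X := PolyadicEqualityAlgebra.inf_diag_le i j X.1
  sub_diag τ i j := Subtype.ext (PolyadicEqualityAlgebra.sub_diag τ i j)

theorem mem_sub {S : SetPEA ι U} {τ : ι → ι} {X : S.Carrier} {s : ι → U} :
    s ∈ (PolyadicAlgebra.sub τ X : S.Carrier).1 ↔ s ∘ τ ∈ X.1 := Iff.rfl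

/-- The inclusion of a polyadic equality set algebra into the full set algebra. -/
def inclusion (S : SetPEA ι U) : S.Carrier ↪[peaLanguage ι] Set (ι → U) where
  toFun X := X.1
  inj' := Subtype.val_injective
  map_fun' {k} F x := by
    cases F <;> rfl
  map_rel' R _ := R.elim

end SetPEA

/-! ### Back-and-forth systems -/

open FirstOrder.Language

/-- A relation that is a partial isomorphism between substructures of `A` and of `B`. -/
structure IsPartialIso (L : FirstOrder.Language.{0, 0}) {A : Type v} {B : Type w}
    [L.Structure A] [L.Structure B] (R : A → B → Prop) : Prop where
  map_fun : ∀ {k : ℕ} (F : L.Functions k) (x : Fin k → A) (y : Fin k → B),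
    (∀ i, R (x i) (y i)) → R (Structure.funMap F x) (Structure.funMap F y)
  map_rel : ∀ {k : ℕ} (r : L.Relations k) (x : Fin k → A) (y : Fin k → B),
    (∀ i, R (x i) (y i)) → (Structure.RelMap r x ↔ Structure.RelMap r y)
  eq_iff : ∀ {a a' b b'}, R a b → R a' b' → (a = a' ↔ b = b')

/-- A back-and-forth system of partial isomorphisms. -/
structure BackAndForth (L : FirstOrder.Language.{0, 0}) {A : Type v} {B : Type w}
    [L.Structure A] [L.Structure B] (S : Set (A → B → Prop)) : Prop where
  isPartialIso : ∀ R ∈ S, IsPartialIso L R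
  forth : ∀ R ∈ S, ∀ a, ∃ R' ∈ S, R ≤ R' ∧ ∃ b, R' a b
  back : ∀ R ∈ S, ∀ b, ∃ R' ∈ S, R ≤ R' ∧ ∃ a, R' a b

section

variable {L : FirstOrder.Language.{0, 0}} {A : Type v} {B : Type w} [L.Structure A] [L.Structure B]

theorem IsPartialIso.realize_term {R : A → B → Prop} (h : IsPartialIso L R) {α : Type*}
    (t : L.Term α) {x : α → A} {y : α → B} (hxy : ∀ i, R (x i) (y i)) :
    R (t.realize x) (t.realize y) := by
  induction t with
  | var a => exact hxy a
  | func F ts ih => exact h.map_fun F _ _ ih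

theorem BackAndForth.realize_iff {S : Set (A → B → Prop)} (hS : BackAndForth L S) {k : ℕ}
    (φ : InfFormula L k) : ∀ R ∈ S, ∀ (x : Fin k → A) (y : Fin k → B), (∀ i, R (x i) (y i)) →
      (φ.Realize A x ↔ φ.Realize B y) := by
  induction φ with
  | equal s t =>
    intro R hR x y hxy
    exact (hS.isPartialIso R hR).eq_iff ((hS.isPartialIso R hR).realize_term s hxy)
      ((hS.isPartialIso R hR).realize_term t hxy)
  | rel r ts =>
    intro R hR x y hxy
    exact (hS.isPartialIso R hR).map_rel r _ _
      fun i => (hS.isPartialIso R hR).realize_term (ts i) hxy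
  | not φ ih =>
    intro R hR x y hxy
    exact not_congr (ih R hR x y hxy)
  | conj φ ih =>
    intro R hR x y hxy
    exact forall_congr' fun i => ih i R hR x y hxy
  | all φ ih =>
    intro R hR x y hxy
    have key : ∀ R' ∈ S, R ≤ R' → ∀ a b, R' a b →
        (φ.Realize A (Fin.snoc x a) ↔ φ.Realize B (Fin.snoc y b)) := by
      intro R' hR' hle a b hab
      refine ih R' hR' _ _ fun i => ?_
      refine Fin.lastCases ?_ (fun j => ?_) i
      · simpa using hab
      · simpa using hle _ _ (hxy j)
    constructor
    · intro h b
      obtain ⟨R', hR', hle, a, hab⟩ := hS.back R hR b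
      exact (key R' hR' hle a b hab).1 (h a)
    · intro h a
      obtain ⟨R', hR', hle, b, hab⟩ := hS.forth R hR a
      exact (key R' hR' hle a b hab).2 (h b)

theorem BackAndForth.infEquiv {S : Set (A → B → Prop)} (hS : BackAndForth L S)
    (hne : S.Nonempty) : InfEquiv L A B := by
  obtain ⟨R, hR⟩ := hne
  exact fun φ => hS.realize_iff φ R hR _ _ fun i => i.elim0

theorem exists_term_realize_eq (c : ℕ → A) (x : Substructure.closure L (Set.range c)) :
    ∃ t : L.Term ℕ, t.realize c = x := by
  obtain ⟨x, hx⟩ := x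
  refine Substructure.closure_induction (p := fun x => ∃ t : L.Term ℕ, t.realize c = x) hx ?_ ?_
  · rintro _ ⟨k, rfl⟩
    exact ⟨Term.var k, rfl⟩
  · intro k F xs hxs
    choose t ht using hxs
    exact ⟨Term.func F t, by simp only [Term.realize_func]; congr 1; exact funext ht⟩

theorem realize_mem_closure_range (c : ℕ → A) (t : L.Term ℕ) :
    t.realize c ∈ Substructure.closure L (Set.range c) :=
  Term.realize_mem t c fun k => Substructure.subset_closure ⟨k, rfl⟩

/-- Two sequences all of whose finite parts are matched by partial isomorphisms generate
isomorphic substructures. -/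
theorem exists_closure_equiv_of_forall_finite {S : Set (A → B → Prop)}
    (hS : ∀ R ∈ S, IsPartialIso L R) (a : ℕ → A) (b : ℕ → B)
    (hab : ∀ k, ∃ R ∈ S, ∀ i < k, R (a i) (b i)) :
    ∃ f : Substructure.closure L (Set.range a) ≃[L] Substructure.closure L (Set.range b),
      ∀ k, (f ⟨a k, Substructure.subset_closure ⟨k, rfl⟩⟩ : B) = b k := by
  classical
  -- Finitely many terms involve only finitely many variables, so one partial isomorphism matches
  -- all their values.
  have key : ∀ F : Finset (L.Term ℕ), ∃ R ∈ S, ∀ t ∈ F, R (t.realize a) (t.realize b) := by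
    intro F
    obtain ⟨k, hk⟩ := (F.biUnion fun t => t.varFinset).exists_nat_subset_range
    obtain ⟨R, hR, h⟩ := hab k
    refine ⟨R, hR, fun t ht => ?_⟩
    have aux : ∀ t : L.Term ℕ, (∀ i ∈ t.varFinset, i < k) → R (t.realize a) (t.realize b) := by
      intro t
      induction t with
      | var i => exact fun hi => h i (hi i (by simp [Term.varFinset]))
      | func f ts ih =>
        intro hi
        refine (hS R hR).map_fun f _ _ fun j => ih j fun i hij => hi i ?_
        simp only [Term.varFinset, Finset.mem_biUnion]
        exact ⟨j, Finset.mem_univ _, hij⟩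
    refine aux t fun i hi => Finset.mem_range.1 (hk ?_)
    exact Finset.mem_biUnion.2 ⟨t, ht, hi⟩
  have heq : ∀ t t' : L.Term ℕ, t.realize a = t'.realize a ↔ t.realize b = t'.realize b := by
    intro t t'
    obtain ⟨R, hR, h⟩ := key {t, t'}
    exact (hS R hR).eq_iff (h t (by simp)) (h t' (by simp))
  choose tA htA using exists_term_realize_eq (L := L) a
  choose tB htB using exists_term_realize_eq (L := L) b
  refine ⟨⟨⟨fun x => ⟨(tA x).realize b, realize_mem_closure_range b _⟩,
    fun y => ⟨(tB y).realize a, realize_mem_closure_range a _⟩, ?_, ?_⟩,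
    ?_, ?_⟩, ?_⟩
  · intro x
    refine Subtype.ext ?_
    change (tB _).realize a = x
    rw [← htA x, heq, htB]
  · intro y
    refine Subtype.ext ?_
    change (tA _).realize b = y
    rw [← htB y, ← heq, htA]
  · intro k F x
    refine Subtype.ext ?_
    change (tA _).realize b = Structure.funMap F fun i => (tA (x i)).realize b
    rw [← Term.realize_func, ← heq, htA, Term.realize_func]
    exact congrArg (Structure.funMap F) (funext fun i => (htA (x i)).symm)
  · intro k r x
    obtain ⟨R, hR, h⟩ := key (Finset.univ.image fun i => tA (x i))
    have := (hS R hR).map_rel r (fun i => (tA (x i)).realize a) (fun i => (tA (x i)).realize b)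
      fun i => h _ (Finset.mem_image_of_mem _ (Finset.mem_univ i))
    refine Iff.trans this.symm ?_
    change Structure.RelMap r _ ↔ Structure.RelMap r fun i => (x i : A)
    rw [show (fun i => (tA (x i)).realize a) = fun i => (x i : A) from funext fun i => htA (x i)]
  · intro k
    change (tA _).realize b = (Term.var k : L.Term ℕ).realize b
    rw [← heq, htA]
    rfl

end

/-! ### Back-and-forth between polyadic equality algebras, atoms and the atom game -/

section Pea

variable {n : ℕ} {A : Type v} {B : Type w} [BooleanAlgebra A] [BooleanAlgebra B]
  [PolyadicEqualityAlgebra (Fin n) A] [PolyadicEqualityAlgebra (Fin n) B]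

theorem IsPartialIso.map_bot {R : A → B → Prop} (h : IsPartialIso (peaLanguage (Fin n)) R) :
    R ⊥ ⊥ :=
  h.map_fun (PEAFunctions.bot : PEAFunctions (Fin n) 0) Fin.elim0 Fin.elim0 fun i => i.elim0

theorem IsPartialIso.map_diag {R : A → B → Prop} (h : IsPartialIso (peaLanguage (Fin n)) R)
    (i j : Fin n) :
    R (PolyadicEqualityAlgebra.diag i j) (PolyadicEqualityAlgebra.diag i j) :=
  h.map_fun (PEAFunctions.diag i j : PEAFunctions (Fin n) 0) Fin.elim0 Fin.elim0 fun i => i.elim0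

theorem IsPartialIso.map_cyl {R : A → B → Prop} (h : IsPartialIso (peaLanguage (Fin n)) R)
    {a : A} {b : B} (hab : R a b) (J : Set (Fin n)) :
    R (PolyadicAlgebra.cyl J a) (PolyadicAlgebra.cyl J b) :=
  h.map_fun (PEAFunctions.cyl J : PEAFunctions (Fin n) 1) (fun _ => a) (fun _ => b) fun _ => hab

theorem IsPartialIso.map_sub {R : A → B → Prop} (h : IsPartialIso (peaLanguage (Fin n)) R)
    {a : A} {b : B} (hab : R a b) (τ : Fin n → Fin n) :
    R (PolyadicAlgebra.sub τ a) (PolyadicAlgebra.sub τ b) :=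
  h.map_fun (PEAFunctions.sub τ : PEAFunctions (Fin n) 1) (fun _ => a) (fun _ => b) fun _ => hab

theorem IsPartialIso.map_inf {R : A → B → Prop} (h : IsPartialIso (peaLanguage (Fin n)) R)
    {a a' : A} {b b' : B} (hab : R a b) (hab' : R a' b') : R (a ⊓ a') (b ⊓ b') :=
  h.map_fun (PEAFunctions.inf : PEAFunctions (Fin n) 2) ![a, a'] ![b, b'] fun i => by
    fin_cases i
    · exact hab
    · exact hab'

theorem IsPartialIso.le_iff {R : A → B → Prop} (h : IsPartialIso (peaLanguage (Fin n)) R)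
    {a a' : A} {b b' : B} (hab : R a b) (hab' : R a' b') : a ≤ a' ↔ b ≤ b' := by
  rw [← inf_eq_left, ← inf_eq_left]
  exact h.eq_iff (h.map_inf hab hab') hab

/-- Being an atom quantifies over one further element, which one more move of the system can supply.
-/
theorem BackAndForth.isAtom_iff {S : Set (A → B → Prop)}
    (hS : BackAndForth (peaLanguage (Fin n)) S) {R : A → B → Prop} (hR : R ∈ S) {a : A} {b : B}
    (hab : R a b) : IsAtom a ↔ IsAtom b := by
  have hiso := hS.isPartialIso
  rw [isAtom_iff_le_of_ge, isAtom_iff_le_of_ge]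
  refine and_congr (not_congr ((hiso R hR).eq_iff hab (hiso R hR).map_bot)) ⟨fun h b' hb' hle => ?_,
    fun h a' ha' hle => ?_⟩
  · obtain ⟨R', hR', hRR', a', hab'⟩ := hS.back R hR b'
    have h1 := (hiso R' hR').eq_iff hab' (hiso R' hR').map_bot
    have h2 := (hiso R' hR').le_iff hab' (hRR' _ _ hab)
    have h3 := (hiso R' hR').le_iff (hRR' _ _ hab) hab'
    exact h3.1 (h a' (fun h => hb' (h1.1 h)) (h2.2 hle))
  · obtain ⟨R', hR', hRR', b', hab'⟩ := hS.forth R hR a'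
    have h1 := (hiso R' hR').eq_iff hab' (hiso R' hR').map_bot
    have h2 := (hiso R' hR').le_iff hab' (hRR' _ _ hab)
    have h3 := (hiso R' hR').le_iff (hRR' _ _ hab) hab'
    exact h3.2 (h b' (fun h => ha' (h1.2 h)) (h2.1 hle))

/-- The restriction of a back-and-forth system to atoms. -/
theorem BackAndForth.atoms {S : Set (A → B → Prop)}
    (hS : BackAndForth (peaLanguage (Fin n)) S) :
    BackAndForth (atomLanguage (Fin n)) ((fun (R : A → B → Prop) (a : Atoms A) (b : Atoms B) =>
      R a b) '' S) where
  isPartialIso := by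
    rintro _ ⟨R, hR, rfl⟩
    have hiso := hS.isPartialIso R hR
    refine ⟨fun F => F.elim, ?_, fun {a a' b b'} h h' => ?_⟩
    · rintro k (⟨i, j⟩ | J | τ) x y hxy
      · exact hiso.le_iff (hxy 0) (hiso.map_diag i j)
      · exact hiso.le_iff (hxy 0) (hiso.map_cyl (hxy 1) J)
      · exact hiso.le_iff (hxy 0) (hiso.map_sub (hxy 1) τ)
    · rw [Subtype.ext_iff, Subtype.ext_iff]
      exact hiso.eq_iff h h'
  forth := by
    rintro _ ⟨R, hR, rfl⟩ a
    obtain ⟨R', hR', hle, b, hab⟩ := hS.forth R hR a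
    exact ⟨_, ⟨R', hR', rfl⟩, fun x y h => hle _ _ h, ⟨b, (hS.isAtom_iff hR' hab).1 a.2⟩, hab⟩
  back := by
    rintro _ ⟨R, hR, rfl⟩ b
    obtain ⟨R', hR', hle, a, hab⟩ := hS.back R hR b
    exact ⟨_, ⟨R', hR', rfl⟩, fun x y h => hle _ _ h, ⟨a, (hS.isAtom_iff hR' hab).2 b.2⟩, hab⟩

/-- The strategy keeps every finite position inside some member of the system. The members need not
have a common extension after ω rounds, but terms are finitary, so the finite positions already
determine the isomorphism. -/
theorem BackAndForth.hasWinningStrategy {S : Set (A → B → Prop)}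
    (hS : BackAndForth (peaLanguage (Fin n)) S) (hne : S.Nonempty) :
    HasWinningStrategy (Fin n) A B := by
  classical
  let Good : (k : ℕ) → (Fin k → Atoms A × Atoms B) → Prop := fun k h =>
    ∃ R ∈ S, ∀ i, R (h i).1 (h i).2
  have hB : ∀ k h (a : Atoms A), ∃ b : Atoms B,
      Good k h → Good (k + 1) (Fin.snoc (α := fun _ => Atoms A × Atoms B) h (a, b)) := by
    intro k h a
    by_cases hg : Good k h
    · obtain ⟨R, hR, hi⟩ := hg
      obtain ⟨_, ⟨R', hR', rfl⟩, hle, b, hab⟩ := hS.atoms.forth _ ⟨R, hR, rfl⟩ a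
      refine ⟨b, fun _ => ⟨R', hR', fun i => ?_⟩⟩
      refine Fin.lastCases ?_ (fun j => ?_) i
      · simpa using hab
      · simpa using hle _ _ (hi j)
    -- At a position matched by no member of the system any atom will do; the system shows that one
    -- exists.
    · obtain ⟨R, hR⟩ := hne
      obtain ⟨_, -, -, b, -⟩ := hS.atoms.forth _ ⟨R, hR, rfl⟩ a
      exact ⟨b, fun h => (hg h).elim⟩
  have hA : ∀ k h (b : Atoms B), ∃ a : Atoms A,
      Good k h → Good (k + 1) (Fin.snoc (α := fun _ => Atoms A × Atoms B) h (a, b)) := by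
    intro k h b
    by_cases hg : Good k h
    · obtain ⟨R, hR, hi⟩ := hg
      obtain ⟨_, ⟨R', hR', rfl⟩, hle, a, hab⟩ := hS.atoms.back _ ⟨R, hR, rfl⟩ b
      refine ⟨a, fun _ => ⟨R', hR', fun i => ?_⟩⟩
      refine Fin.lastCases ?_ (fun j => ?_) i
      · simpa using hab
      · simpa using hle _ _ (hi j)
    · obtain ⟨R, hR⟩ := hne
      obtain ⟨_, -, -, a, -⟩ := hS.atoms.back _ ⟨R, hR, rfl⟩ b
      exact ⟨a, fun h => (hg h).elim⟩
  choose fB hfB using hB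
  choose fA hfA using hA
  refine ⟨⟨fB, fA⟩, fun p hp => ?_⟩
  have hsnoc : ∀ k, (fun i : Fin (k + 1) => p i) =
      Fin.snoc (α := fun _ => Atoms A × Atoms B) (fun i : Fin k => p i) ((p k).1, (p k).2) := by
    intro k
    funext i
    refine Fin.lastCases ?_ (fun j => ?_) i <;> simp
  have hgood : ∀ k, Good k fun i => p i := by
    intro k
    induction k with
    | zero =>
      obtain ⟨R, hR⟩ := hne
      exact ⟨R, hR, fun i => i.elim0⟩
    | succ k ih =>
      rw [hsnoc]
      rcases hp k with h | h
      · have := hfB k _ (p k).1 ih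
        rwa [← show (p k).2 = fB k _ (p k).1 from h] at this
      · have := hfA k _ (p k).2 ih
        rwa [← show (p k).1 = fA k _ (p k).2 from h] at this
  refine exists_closure_equiv_of_forall_finite hS.isPartialIso _ _ fun k => ?_
  obtain ⟨R, hR, h⟩ := hgood k
  exact ⟨R, hR, fun i hi => h ⟨i, hi⟩⟩

end Pea

/-! ### A generic valued structure -/

/-- The group of colours, of exponent two. -/
abbrev ColorGroup : Type := ℕ → ZMod 2

/-- The values: a block index and an element of the group of colours. -/
abbrev Val : Type := ℕ × ColorGroup

/-- The points of the generic structure: a sort, a code of a finite table of values, a rank. -/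
abbrev Point : Type := Bool × (ℕ → Bool) × ℕ

instance : Uncountable ColorGroup := by
  rw [← Cardinal.aleph0_lt_mk_iff]
  simp [ColorGroup, Cardinal.aleph0_lt_continuum]

instance : Uncountable Point := by
  rw [← Cardinal.aleph0_lt_mk_iff]
  simp [Point, Cardinal.mk_prod, Cardinal.aleph0_lt_continuum]

namespace Point

/-- Finite tables of values of tuples; `none` stands for the point the table belongs to. -/
abbrev Table (m : ℕ) : Type := (Option Point × (Fin m → Option Point)) →₀ Val

/-- A cardinality count: there are only continuum many finitely supported tables, since keys are
finite tuples from a set of size continuum and so are the values. This lets points be coded without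
a transfinite construction. -/
theorem exists_surjective_table (m : ℕ) : ∃ f : (ℕ → Bool) → Table m, Function.Surjective f := by
  have h2 : Cardinal.mk (ℕ → Bool) = Cardinal.continuum := by simp
  have h3 : Cardinal.mk Point = Cardinal.continuum := by
    simp [Point, Cardinal.mk_prod]
  have h4 : Cardinal.mk (Option Point) = Cardinal.continuum := by
    rw [Cardinal.mk_option, h3]
    exact Cardinal.add_one_eq Cardinal.aleph0_le_continuum
  have h5 : Cardinal.mk (Fin m → Option Point) ≤ Cardinal.continuum := by
    rw [← Cardinal.power_def, h4, Cardinal.mk_fin]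
    exact Cardinal.power_nat_le Cardinal.aleph0_le_continuum
  have h6 : Cardinal.mk Val = Cardinal.continuum := by
    simp [Val, ColorGroup, Cardinal.mk_prod]
  have h7 : Cardinal.mk (Table m) ≤ Cardinal.mk (ℕ → Bool) := by
    rw [h2, Table, Cardinal.mk_finsupp_of_infinite', h6, Cardinal.mk_prod]
    simp only [Cardinal.lift_id]
    refine max_le ?_ le_rfl
    rw [h4]
    exact (mul_le_mul' le_rfl h5).trans (by simp)
  obtain ⟨e⟩ := h7
  exact ⟨Function.invFun e, Function.invFun_surjective e.injective⟩

/-- The table coded by an element of the Cantor space. -/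
noncomputable def table (m : ℕ) : (ℕ → Bool) → Table m := (exists_surjective_table m).choose

/-- The point `d` is the unique point of maximal rank in a tuple. -/
def IsTop {m : ℕ} (d x : Point) (w : Fin m → Point) : Prop :=
  (x = d ∨ ∃ i, w i = d) ∧ (x ≠ d → x.2.2 < d.2.2) ∧ ∀ i, w i ≠ d → (w i).2.2 < d.2.2

theorem IsTop.unique {m : ℕ} {d d' x : Point} {w : Fin m → Point} (h : IsTop d x w)
    (h' : IsTop d' x w) : d = d' := by
  by_contra hne
  have h1 : d'.2.2 < d.2.2 := by
    rcases h'.1 with rfl | ⟨i, rfl⟩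
    · exact h.2.1 (Ne.symm hne)
    · exact h.2.2 i (Ne.symm hne)
  have h2 : d.2.2 < d'.2.2 := by
    rcases h.1 with rfl | ⟨i, rfl⟩
    · exact h'.2.1 hne
    · exact h'.2.2 i hne
  exact lt_asymm h1 h2

open Classical in
/-- The value of a tuple, read off from the table of its point of maximal rank. -/
noncomputable def val {m : ℕ} (x : Point) (w : Fin m → Point) : Val :=
  if h : ∃ d, IsTop d x w then
    table m h.choose.2.1 (if x = h.choose then none else some x,
      fun i => if w i = h.choose then none else some (w i))
  else 0

open Classical in
theorem val_eq_of_isTop {m : ℕ} {d x : Point} {w : Fin m → Point} (h : IsTop d x w) :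
    val x w = table m d.2.1 (if x = d then none else some x,
      fun i => if w i = d then none else some (w i)) := by
  have hex : ∃ d, IsTop d x w := ⟨d, h⟩
  have hd : hex.choose = d := hex.choose_spec.unique h
  rw [val, dif_pos hex, hd]

/-- Genericity: over a finite set of points, there is a new point for which all values are
prescribed. -/
theorem exists_val_eq {m : ℕ} (D : Finset Point) (σ : Bool)
    (φ : Option Point → (Fin m → Option Point) → Val) :
    ∃ u ∉ D, u.1 = σ ∧ ∀ a b, (∀ y, a = some y → y ∈ D) → (∀ i y, b i = some y → y ∈ D) →
      (a = none ∨ ∃ i, b i = none) →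
      val (a.getD u) (fun i => (b i).getD u) = φ a b := by
  classical
  let K : Finset (Option Point) := insert none (D.image some)
  -- The prescription is restricted to finitely many keys and written into the code of the new
  -- point; its rank r exceeds all ranks in D, so every tuple containing it reads its values from
  -- this table.
  let T : Table m := Finsupp.indicator (K ×ˢ Fintype.piFinset fun _ => K) fun k _ => φ k.1 k.2
  obtain ⟨c, hc⟩ := (exists_surjective_table m).choose_spec T
  obtain ⟨r, hr⟩ := (D.image fun y => y.2.2).exists_nat_subset_range
  have hlt : ∀ y ∈ D, y.2.2 < r := fun y hy =>
    Finset.mem_range.1 (hr (Finset.mem_image_of_mem _ hy))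
  let u : Point := (σ, c, r)
  have hu : u ∉ D := fun h => lt_irrefl r (hlt u h)
  refine ⟨u, hu, rfl, fun a b ha hb hab => ?_⟩
  have hget : ∀ o : Option Point, (∀ y, o = some y → y ∈ D) →
      (if o.getD u = u then none else some (o.getD u)) = o ∧
      (o.getD u ≠ u → (o.getD u).2.2 < u.2.2) ∧ o ∈ K := by
    intro o ho
    cases o with
    | none => simp [K]
    | some y =>
      have hy := ho y rfl
      have hne : y ≠ u := fun h => hu (h ▸ hy)
      simp [hne, K, hy, hlt y hy, u]
  have htop : IsTop u (a.getD u) (fun i => (b i).getD u) := by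
    refine ⟨?_, (hget a ha).2.1, fun i => (hget (b i) (hb i)).2.1⟩
    rcases hab with rfl | ⟨i, hi⟩
    · exact Or.inl rfl
    · exact Or.inr ⟨i, by simp [hi]⟩
  rw [val_eq_of_isTop htop, (hget a ha).1,
    show (fun i => if (b i).getD u = u then none else some ((b i).getD u)) = b from
      funext fun i => (hget (b i) (hb i)).1]
  have hT : table m u.2.1 = T := hc
  rw [hT, Finsupp.indicator_of_mem]
  exact Finset.mem_product.2 ⟨(hget a ha).2.2, Fintype.mem_piFinset.2 fun i => (hget (b i) (hb i)).2.2⟩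

end Point

/-! ### Matched tuples of the generic structure -/

/-- Conditions on two pairs of values of points of two given sorts. -/
abbrev Matching : Type := Bool → Bool → Val → Val → Val → Val → Prop

namespace Matching

/-- Any family of at most `N` matched pairs of values can be extended by any value. -/
def Extends (M : Matching) (N : ℕ) : Prop :=
  ∀ P : Finset (Bool × Val × Val), P.card ≤ N →
    (∀ a ∈ P, ∀ b ∈ P, M a.1 b.1 a.2.1 b.2.1 a.2.2 b.2.2) →
    ∀ σ v, ∃ v', M σ σ v v v' v' ∧ ∀ a ∈ P, M σ a.1 v a.2.1 v' a.2.2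

/-- Interchanging the two pairs keeps the matching. -/
protected def Symm (M : Matching) : Prop :=
  ∀ ⦃σ τ v w v' w'⦄, M σ τ v w v' w' → M τ σ w v w' v'

/-- Values are added one at a time, each extending the at most N already treated. The answer is a
function of sort and value, so that indices carrying the same point receive the same answer. -/
theorem Extends.exists_family {M : Matching} {N : ℕ} (hext : M.Extends N) (hM : M.Symm)
    (Q : Finset (Bool × Val)) (hQ : Q.card ≤ N + 1) :
    ∃ F : Bool → Val → Val, ∀ a ∈ Q, ∀ b ∈ Q, M a.1 b.1 a.2 b.2 (F a.1 a.2) (F b.1 b.2) := by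
  classical
  induction Q using Finset.induction_on with
  | empty => exact ⟨fun _ v => v, by simp⟩
  | insert q Q hq ih =>
    rw [Finset.card_insert_of_notMem hq] at hQ
    obtain ⟨F, hF⟩ := ih (by omega)
    obtain ⟨v', hv', hP⟩ := hext (Q.image fun a => (a.1, a.2, F a.1 a.2))
      (Finset.card_image_le.trans (by omega)) (by
        simp only [Finset.forall_mem_image]
        exact hF) q.1 q.2
    simp only [Finset.forall_mem_image] at hP
    have hne : ∀ a ∈ Q, (if (a.1, a.2) = q then v' else F a.1 a.2) = F a.1 a.2 := fun a ha =>
      if_neg fun h : a = q => hq (h ▸ ha)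
    refine ⟨fun σ v => if (σ, v) = q then v' else F σ v, fun a ha b hb => ?_⟩
    rw [Finset.mem_insert] at ha hb
    rcases ha with rfl | ha <;> rcases hb with rfl | hb
    · simpa using hv'
    · simpa only [hne b hb, Prod.mk.eta, if_true] using hP hb
    · simpa only [hne a ha, Prod.mk.eta, if_true] using hM (hP ha)
    · simpa only [hne a ha, hne b hb] using hF a ha b hb

end Matching

/-- The tuples `s` and `s'` agree, on the indices in `D`, in equalities and sorts, and their values
are matched by `M`. -/
structure Matched (m : ℕ) {ι : Type u} (D : Set ι) (M : Matching) (s s' : ι → Point) : Prop where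
  eq_iff : ∀ i ∈ D, ∀ j ∈ D, s i = s j ↔ s' i = s' j
  sort_eq : ∀ i ∈ D, (s i).1 = (s' i).1
  matching : ∀ k : Fin m → ι, (∀ a, k a ∈ D) → Function.Injective (s ∘ k) → ∀ i ∈ D, ∀ j ∈ D,
    s i ∉ Set.range (s ∘ k) → s j ∉ Set.range (s ∘ k) →
    M (s i).1 (s j).1 (Point.val (s i) (s ∘ k)) (Point.val (s j) (s ∘ k))
      (Point.val (s' i) (s' ∘ k)) (Point.val (s' j) (s' ∘ k))

namespace Matched

variable {m : ℕ} {ι : Type u} {κ : Type v} {D : Set ι} {M : Matching} {s s' t t' : ι → Point}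

theorem comp (h : Matched m D M s s') {D' : Set κ} (τ : κ → ι) (hτ : Set.MapsTo τ D' D) :
    Matched m D' M (s ∘ τ) (s' ∘ τ) where
  eq_iff _ hi _ hj := h.eq_iff _ (hτ hi) _ (hτ hj)
  sort_eq _ hi := h.sort_eq _ (hτ hi)
  matching k hk hinj _ hi _ hj hi' hj' :=
    h.matching (τ ∘ k) (fun a => hτ (hk a)) hinj _ (hτ hi) _ (hτ hj) hi' hj'

theorem congr (h : Matched m D M s s') (ht : ∀ i ∈ D, s i = t i) (ht' : ∀ i ∈ D, s' i = t' i) :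
    Matched m D M t t' where
  eq_iff i hi j hj := by rw [← ht i hi, ← ht j hj, ← ht' i hi, ← ht' j hj, h.eq_iff i hi j hj]
  sort_eq i hi := by rw [← ht i hi, ← ht' i hi, h.sort_eq i hi]
  matching k hk hinj i hi j hj hi' hj' := by
    have e : t ∘ k = s ∘ k := funext fun a => (ht _ (hk a)).symm
    have e' : t' ∘ k = s' ∘ k := funext fun a => (ht' _ (hk a)).symm
    rw [e] at hinj hi' hj'
    rw [← ht i hi] at hi'
    rw [← ht j hj] at hj'
    rw [e, e', ← ht i hi, ← ht j hj, ← ht' i hi, ← ht' j hj]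
    exact h.matching k hk hinj i hi j hj hi' hj'

theorem mono_index (h : Matched m D M s s') {D' : Set ι} (hD : D' ⊆ D) : Matched m D' M s s' :=
  h.comp id hD

theorem mono {M' : Matching} (hM : ∀ ⦃σ τ v w v' w'⦄, M σ τ v w v' w' → M' σ τ v w v' w')
    (h : Matched m D M s s') : Matched m D M' s s' where
  eq_iff := h.eq_iff
  sort_eq := h.sort_eq
  matching k hk hinj i hi j hj hi' hj' := hM (h.matching k hk hinj i hi j hj hi' hj')

theorem comp_injective (h : Matched m D M s s') {α : Type*} {k : α → ι} (hk : ∀ a, k a ∈ D)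
    (hinj : Function.Injective (s' ∘ k)) : Function.Injective (s ∘ k) := fun a b hab =>
  hinj ((h.eq_iff _ (hk a) _ (hk b)).1 hab)

theorem mem_range_iff (h : Matched m D M s s') {α : Type*} {k : α → ι} (hk : ∀ a, k a ∈ D) {i : ι}
    (hi : i ∈ D) : s i ∈ Set.range (s ∘ k) ↔ s' i ∈ Set.range (s' ∘ k) :=
  exists_congr fun a => h.eq_iff _ (hk a) _ hi

theorem symm {M' : Matching} (hM : ∀ ⦃σ τ v w v' w'⦄, M σ τ v w v' w' → M' σ τ v' w' v w)
    (h : Matched m D M s s') : Matched m D M' s' s where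
  eq_iff i hi j hj := (h.eq_iff i hi j hj).symm
  sort_eq i hi := (h.sort_eq i hi).symm
  matching k hk hinj i hi j hj hi' hj' := by
    rw [← h.sort_eq i hi, ← h.sort_eq j hj]
    rw [← h.mem_range_iff hk hi] at hi'
    rw [← h.mem_range_iff hk hj] at hj'
    exact hM (h.matching k hk (h.comp_injective hk hinj) i hi j hj hi' hj')

theorem refl (hM : ∀ σ τ v w, M σ τ v w v w) (s : ι → Point) : Matched m D M s s where
  eq_iff _ _ _ _ := Iff.rfl
  sort_eq _ _ := rfl
  matching _ _ _ _ _ _ _ _ _ := hM ..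

theorem const (hM : ∀ σ v, M σ σ v v v v) (u : Point) :
    Matched m D M (fun _ => u) (fun _ => u) where
  eq_iff _ _ _ _ := Iff.rfl
  sort_eq _ _ := rfl
  matching _ _ _ _ _ _ _ _ _ := hM ..

theorem trans {M' M'' : Matching}
    (hM : ∀ ⦃σ τ v w v' w' v'' w''⦄, M σ τ v w v' w' → M' σ τ v' w' v'' w'' →
      M'' σ τ v w v'' w'')
    (h : Matched m D M s s') (h' : Matched m D M' s' t) : Matched m D M'' s t where
  eq_iff i hi j hj := (h.eq_iff i hi j hj).trans (h'.eq_iff i hi j hj)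
  sort_eq i hi := (h.sort_eq i hi).trans (h'.sort_eq i hi)
  matching k hk hinj i hi j hj hi' hj' := by
    refine hM (h.matching k hk hinj i hi j hj hi' hj') ?_
    rw [h.mem_range_iff hk hi] at hi'
    rw [h.mem_range_iff hk hj] at hj'
    rw [h.sort_eq i hi, h.sort_eq j hj]
    exact h'.matching k hk (fun a b hab => hinj ((h.eq_iff _ (hk a) _ (hk b)).2 hab)) i hi j hj
      hi' hj'

-- The heart of the back-and-forth: choose the new point generically, prescribing its values so that
-- the matching survives. Once m distinct parameters are removed, at most N + 1 indices of D remain,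
-- which is the number of values that the extension property handles.
open Classical in
theorem exists_update_of_notMem {D : Finset ι} {N : ℕ} (hM : M.Symm) (hext : M.Extends N)
    (hD : D.card ≤ N + m + 1) (h : Matched m (D : Set ι) M s s') {j : ι} (hj : j ∈ D) (x : Point)
    (hx : ∀ l ∈ D, l ≠ j → s l ≠ x) :
    ∃ x', Matched m (D : Set ι) M (Function.update s j x) (Function.update s' j x') := by
  set t := Function.update s j x with ht
  have htj : t j = x := Function.update_self ..
  have hts : ∀ {i}, i ≠ j → t i = s i := fun hi => Function.update_of_ne hi ..
  let E := (D.erase j).image s'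
  have hpos : ∀ y : Point, ∃ i, y ∈ E → (i ∈ D ∧ i ≠ j) ∧ s' i = y := by
    intro y
    by_cases hy : y ∈ E
    · obtain ⟨i, hi, rfl⟩ := Finset.mem_image.1 hy
      exact ⟨i, fun _ => ⟨(Finset.mem_erase.1 hi).symm, rfl⟩⟩
    · exact ⟨j, fun h => (hy h).elim⟩
  choose pos hpos using hpos
  have hE : ∀ {i}, i ∈ D → i ≠ j → s' i ∈ E := fun hi hij =>
    Finset.mem_image_of_mem _ (Finset.mem_erase.2 ⟨hij, hi⟩)
  have htpos : ∀ {i}, i ∈ D → i ≠ j → t (pos (s' i)) = t i := by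
    intro i hi hij
    obtain ⟨⟨h1, h2⟩, h3⟩ := hpos _ (hE hi hij)
    rw [hts h2, hts hij, h.eq_iff _ h1 _ hi, h3]
  -- A key of a table is translated back into indices; `none`, the new point, becomes j.
  let K : (Fin m → Option Point) → Fin m → ι := fun b a => (b a).elim j pos
  have hK : ∀ b, (∀ a y, b a = some y → y ∈ E) → ∀ a, K b a ∈ D := by
    intro b hb a
    cases hba : b a with
    | none => simpa [K, hba] using hj
    | some y => simpa [K, hba] using (hpos y (hb a y hba)).1.1
  have hcard : ∀ (k : Fin m → ι), (∀ a, k a ∈ D) → Function.Injective (t ∘ k) →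
      (D.filter fun i => t i ∉ Set.range (t ∘ k)).card ≤ N + 1 := by
    intro k hk hinj
    have h1 : (D.filter fun i => t i ∉ Set.range (t ∘ k)) ⊆ D \ Finset.univ.image k := by
      intro i hi
      rw [Finset.mem_filter] at hi
      refine Finset.mem_sdiff.2 ⟨hi.1, fun hik => hi.2 ?_⟩
      obtain ⟨a, -, rfl⟩ := Finset.mem_image.1 hik
      exact ⟨a, rfl⟩
    have h2 : (Finset.univ.image k).card = m := by
      rw [Finset.card_image_of_injective _ hinj.of_comp, Finset.card_univ, Fintype.card_fin]
    have h3 := Finset.card_le_card h1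
    rw [Finset.card_sdiff_of_subset (by simpa [Finset.subset_iff] using hk), h2] at h3
    omega
  -- Parameter tuples that contain the new point: all values over them are still free, and a whole
  -- matched family is chosen.
  have hF : ∀ b : Fin m → Option Point, ∃ F : Bool → Val → Val, (∀ a y, b a = some y → y ∈ E) →
      Function.Injective (t ∘ K b) → ∀ i ∈ D, ∀ i' ∈ D,
      t i ∉ Set.range (t ∘ K b) → t i' ∉ Set.range (t ∘ K b) →
      M (t i).1 (t i').1 (Point.val (t i) (t ∘ K b)) (Point.val (t i') (t ∘ K b))
        (F (t i).1 (Point.val (t i) (t ∘ K b))) (F (t i').1 (Point.val (t i') (t ∘ K b))) := by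
    intro b
    by_cases hb : (∀ a y, b a = some y → y ∈ E) ∧ Function.Injective (t ∘ K b)
    · obtain ⟨F, hF⟩ := hext.exists_family hM
        ((D.filter fun i => t i ∉ Set.range (t ∘ K b)).image
          fun i => ((t i).1, Point.val (t i) (t ∘ K b)))
        (Finset.card_image_le.trans (hcard _ (hK b hb.1) hb.2))
      refine ⟨F, fun _ _ i hi i' hi' hir hir' => ?_⟩
      exact hF _ (Finset.mem_image_of_mem _ (Finset.mem_filter.2 ⟨hi, hir⟩)) _
        (Finset.mem_image_of_mem _ (Finset.mem_filter.2 ⟨hi', hir'⟩))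
    · exact ⟨fun _ v => v, fun h1 h2 => (hb ⟨h1, h2⟩).elim⟩
  -- Parameter tuples of old points: the values of the other old points are fixed, and only the
  -- value of the new point has to be added to a family of at most N.
  have hG : ∀ b : Fin m → Option Point, ∃ v', (∀ a y, b a = some y → y ∈ E) →
      Function.Injective (t ∘ K b) → (∀ a, b a ≠ none) → x ∉ Set.range (t ∘ K b) →
      M x.1 x.1 (Point.val x (t ∘ K b)) (Point.val x (t ∘ K b)) v' v' ∧
      ∀ i ∈ D, i ≠ j → t i ∉ Set.range (t ∘ K b) →
        M x.1 (t i).1 (Point.val x (t ∘ K b)) (Point.val (t i) (t ∘ K b)) v'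
          (Point.val (s' i) (s' ∘ K b)) := by
    intro b
    by_cases hb : (∀ a y, b a = some y → y ∈ E) ∧ Function.Injective (t ∘ K b) ∧
      (∀ a, b a ≠ none) ∧ x ∉ Set.range (t ∘ K b)
    · obtain ⟨hbE, hinj, hbn, hxr⟩ := hb
      have hKj : ∀ a, K b a ≠ j := by
        intro a
        obtain ⟨y, hy⟩ := Option.ne_none_iff_exists'.1 (hbn a)
        simpa [K, hy] using (hpos y (hbE a y hy)).1.2
      have hsK : s ∘ K b = t ∘ K b := funext fun a => (hts (hKj a)).symm
      obtain ⟨v', h1, h2⟩ := hext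
        (((D.filter fun i => t i ∉ Set.range (t ∘ K b)).erase j).image
          fun i => ((t i).1, Point.val (t i) (t ∘ K b), Point.val (s' i) (s' ∘ K b)))
        (by
          refine Finset.card_image_le.trans ?_
          rw [Finset.card_erase_of_mem (Finset.mem_filter.2 ⟨hj, htj ▸ hxr⟩)]
          have := hcard _ (hK b hbE) hinj
          omega)
        (by
          simp only [Finset.forall_mem_image, Finset.mem_erase, Finset.mem_filter]
          rintro i ⟨hij, hi, hir⟩ i' ⟨hij', hi', hir'⟩
          have := h.matching (K b) (hK b hbE) (by rwa [hsK]) i hi i' hi'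
            (by rwa [hsK, ← hts hij]) (by rwa [hsK, ← hts hij'])
          rwa [hsK, ← hts hij, ← hts hij'] at this) x.1 (Point.val x (t ∘ K b))
      simp only [Finset.forall_mem_image, Finset.mem_erase, Finset.mem_filter] at h2
      exact ⟨v', fun _ _ _ _ => ⟨h1, fun i hi hij hir => h2 ⟨hij, hi, hir⟩⟩⟩
    · exact ⟨0, fun h1 h2 h3 h4 => (hb ⟨h1, h2, h3, h4⟩).elim⟩
  choose F hF using hF
  choose G hG using hG
  obtain ⟨x', hx'E, hx's, hval⟩ := Point.exists_val_eq (m := m) E x.1 fun o b =>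
    o.elim (G b) fun y => F b (t (pos y)).1 (Point.val (t (pos y)) (t ∘ K b))
  refine ⟨x', ?_⟩
  set t' := Function.update s' j x' with ht'
  have htj' : t' j = x' := Function.update_self ..
  have hts' : ∀ {i}, i ≠ j → t' i = s' i := fun hi => Function.update_of_ne hi ..
  have hne : ∀ {i}, i ∈ D → i ≠ j → t i ≠ x := fun hi hij => by
    rw [hts hij]; exact hx _ hi hij
  have hne' : ∀ {i}, i ∈ D → i ≠ j → t' i ≠ x' := fun hi hij heq => by
    rw [hts' hij] at heq
    exact hx'E (heq ▸ hE hi hij)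
  refine ⟨fun i hi i' hi' => ?_, fun i hi => ?_, fun k hk hinj i hi i' hi' hir hir' => ?_⟩
  · by_cases hij : i = j
    · by_cases hij' : i' = j
      · rw [hij, hij']; simp
      · rw [hij, htj, htj']
        exact iff_of_false (hne hi' hij').symm (hne' hi' hij').symm
    · by_cases hij' : i' = j
      · rw [hij', htj, htj']
        exact iff_of_false (hne hi hij) (hne' hi hij)
      · rw [hts hij, hts hij', hts' hij, hts' hij']
        exact h.eq_iff i hi i' hi'
  · by_cases hij : i = j
    · rw [hij, htj, htj', hx's]
    · rw [hts hij, hts' hij]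
      exact h.sort_eq i hi
  · let o : ι → Option Point := fun i => if i = j then none else some (s' i)
    have hoE : ∀ i ∈ D, ∀ y, o i = some y → y ∈ E := by
      intro i hi y hy
      by_cases hij : i = j
      · simp [o, hij] at hy
      · simp only [o, hij, if_false, Option.some.injEq] at hy
        exact hy ▸ hE hi hij
    have hoget : ∀ i, (o i).getD x' = t' i := by
      intro i
      by_cases hij : i = j
      · simp [o, hij, htj']
      · simp [o, hij, hts' hij]
    -- The index returned by `pos` may differ from the original one, but it carries the same point.
    have htK : t ∘ K (o ∘ k) = t ∘ k := by
      funext a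
      by_cases hij : k a = j
      · simp [K, o, hij]
      · simpa [K, o, hij] using htpos (hk a) hij
    have hvalo : ∀ i ∈ D, (i = j ∨ ∃ a, k a = j) → Point.val (t' i) (t' ∘ k) =
        (o i).elim (G (o ∘ k)) fun y => F (o ∘ k) (t (pos y)).1 (Point.val (t (pos y)) (t ∘ k)) := by
      intro i hi hor
      have := hval (o i) (o ∘ k) (hoE i hi) (fun a => hoE _ (hk a)) (by
        rcases hor with rfl | ⟨a, ha⟩
        · exact Or.inl (by simp [o])
        · exact Or.inr ⟨a, by simp [o, ha]⟩)
      rw [htK] at this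
      simpa only [hoget, Function.comp_def] using this
    -- With j among the parameters all values come from F; otherwise only the value of the point at
    -- j is new, and it comes from G.
    by_cases hkj : ∃ a, k a = j
    · have hij : ∀ {i}, t i ∉ Set.range (t ∘ k) → i ≠ j := by
        rintro i hir rfl
        obtain ⟨a, ha⟩ := hkj
        exact hir ⟨a, congrArg t ha⟩
      have hvi : ∀ {i}, i ∈ D → i ≠ j →
          Point.val (t' i) (t' ∘ k) = F (o ∘ k) (t i).1 (Point.val (t i) (t ∘ k)) := by
        intro i hi hij
        rw [hvalo i hi (Or.inr hkj)]
        simp only [o, hij, if_false, Option.elim_some, htpos hi hij]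
      have := hF (o ∘ k) (fun a => hoE _ (hk a)) (by rwa [htK]) i hi i' hi' (by rwa [htK])
        (by rwa [htK])
      rw [hvi hi (hij hir), hvi hi' (hij hir')]
      rwa [htK] at this
    · push Not at hkj
      have hsk : t ∘ k = s ∘ k := funext fun a => hts (hkj a)
      have hsk' : t' ∘ k = s' ∘ k := funext fun a => hts' (hkj a)
      have hsK' : s' ∘ K (o ∘ k) = s' ∘ k := by
        funext a
        simpa [K, o, hkj a] using (hpos _ (hE (hk a) (hkj a))).2
      have hvj : Point.val (t' j) (t' ∘ k) = G (o ∘ k) := by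
        rw [hvalo j hj (Or.inl rfl)]
        simp [o]
      have hGk : t j ∉ Set.range (t ∘ k) → _ := fun hjr =>
        hG (o ∘ k) (fun a => hoE _ (hk a)) (by rwa [htK]) (fun a => by simp [o, hkj a])
          (by rwa [htK, ← htj])
      rw [htK, hsK', ← hsk'] at hGk
      by_cases hij : i = j
      · rw [hij] at hir ⊢
        by_cases hij' : i' = j
        · rw [hij', hvj, htj]
          exact (hGk hir).1
        · rw [hvj, htj, hts' hij']
          exact (hGk hir).2 i' hi' hij' hir'
      · by_cases hij' : i' = j
        · rw [hij'] at hir' ⊢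
          rw [hvj, htj, hts' hij]
          exact hM ((hGk hir').2 i hi hij hir)
        · rw [hsk, hts hij] at hir
          rw [hsk, hts hij'] at hir'
          rw [hsk, hsk', hts hij, hts hij', hts' hij, hts' hij']
          exact h.matching k hk (by rwa [← hsk]) i hi i' hi' hir hir'

-- A point already present at another index is copied: both updates are then substitutions by the
-- same map of indices, and no genericity is needed.
open Classical in
theorem exists_update {D : Finset ι} {N : ℕ} (hM : M.Symm) (hext : M.Extends N)
    (hD : D.card ≤ N + m + 1) (h : Matched m (D : Set ι) M s s') {j : ι} (hj : j ∈ D) (x : Point) :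
    ∃ x', Matched m (D : Set ι) M (Function.update s j x) (Function.update s' j x') := by
  by_cases hx : ∀ l ∈ D, l ≠ j → s l ≠ x
  · exact h.exists_update_of_notMem hM hext hD hj x hx
  · push Not at hx
    obtain ⟨l, hl, -, rfl⟩ := hx
    have e : ∀ r : ι → Point, Function.update r j (r l) = r ∘ Function.update id j l := by
      intro r
      funext i
      by_cases hij : i = j
      · subst hij; simp
      · simp [hij]
    refine ⟨s' l, ?_⟩
    rw [e, e]
    refine h.comp _ fun i hi => ?_
    by_cases hij : i = j
    · subst hij; simpa using hl
    · simpa [hij] using hi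

/-- This is what makes cylindrifications respect the matching. Only the finitely many indices in D ∩
J matter, even when J is infinite, and they are updated one after the other. -/
theorem exists_forth {D : Finset ι} {N : ℕ} (hM : M.Symm) (hext : M.Extends N)
    (hD : D.card ≤ N + m + 1) (h : Matched m (D : Set ι) M s s') (J : Set ι)
    (hst : ∀ i ∉ J, s i = t i) :
    ∃ t', (∀ i ∉ J, s' i = t' i) ∧ Matched m (D : Set ι) M t t' := by
  classical
  have key : ∀ K : Finset ι, K ⊆ D.filter (· ∈ J) →
      ∃ t', (∀ i ∉ J, s' i = t' i) ∧ Matched m (D : Set ι) M (K.piecewise t s) t' := by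
    intro K
    induction K using Finset.induction_on with
    | empty => exact fun _ => ⟨s', fun _ _ => rfl, by simpa using h⟩
    | insert j K hj ih =>
      intro hK
      obtain ⟨t', ht', hm⟩ := ih ((Finset.subset_insert _ _).trans hK)
      have hjD := Finset.mem_filter.1 (hK (Finset.mem_insert_self j K))
      obtain ⟨x', hx'⟩ := hm.exists_update hM hext hD hjD.1 (t j)
      refine ⟨Function.update t' j x', fun i hi => ?_, ?_⟩
      · rw [Function.update_of_ne (fun h : i = j => hi (h ▸ hjD.2)), ht' i hi]
      · rwa [Finset.piecewise_insert]
  obtain ⟨t', ht', hm⟩ := key _ subset_rfl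
  refine ⟨t', ht', hm.congr (fun i hi => ?_) fun _ _ => rfl⟩
  by_cases hiJ : i ∈ J
  · exact Finset.piecewise_eq_of_mem _ _ _ (Finset.mem_filter.2 ⟨hi, hiJ⟩)
  · rw [Finset.piecewise_eq_of_notMem _ _ _ (fun h => hiJ (Finset.mem_filter.1 h).2), hst i hiJ]

end Matched

/-! ### Matching of colours -/

theorem ColorGroup.add_self (g : ColorGroup) : g + g = 0 := by
  funext i
  exact CharTwo.add_self_eq_zero (g i)

theorem ColorGroup.add_add_cancel (g h : ColorGroup) : g + (g + h) = h := by
  rw [← add_assoc, add_self, zero_add]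

theorem ColorGroup.add_add_cancel_right (g h : ColorGroup) : g + h + g = h := by
  rw [add_comm g h, add_assoc, add_self, add_zero]

/-- The block indices in `E`, the colours in `F` of pairs of points of the same sort, and the
colours of pairs of points of different sorts are matched; the latter, which are the images under
`π` and `π'` of the differences, along the partial map `f`. -/
structure ColorMatched {S S' : Type} (π : ColorGroup → S) (π' : ColorGroup → S') (E : Set ℕ)
    (F : Set ColorGroup) (f : Set (S × S')) (σ τ : Bool) (v w v' w' : Val) : Prop where
  left : ∀ e ∈ E, v.1 = e ↔ v'.1 = e
  right : ∀ e ∈ E, w.1 = e ↔ w'.1 = e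
  same : σ = τ → ∀ g ∈ F, (v.1 = w.1 ∧ v.2 + w.2 = g) ↔ (v'.1 = w'.1 ∧ v'.2 + w'.2 = g)
  cross : σ ≠ τ → ∀ p ∈ f, (v.1 = w.1 ∧ π (v.2 + w.2) = p.1) ↔ (v'.1 = w'.1 ∧ π' (v'.2 + w'.2) = p.2)

namespace ColorMatched

variable {S S' S'' : Type} {π : ColorGroup → S} {π' : ColorGroup → S'} {π'' : ColorGroup → S''}
  {E E' : Set ℕ} {F F' : Set ColorGroup} {f : Set (S × S')} {σ τ : Bool} {v w v' w' v'' w'' : Val}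

theorem symm : Matching.Symm (ColorMatched π π' E F f) := fun σ τ v w v' w' h =>
  ⟨h.right, h.left, fun hs g hg => by
    rw [eq_comm, add_comm, @eq_comm _ w'.1, add_comm w'.2]; exact h.same hs.symm g hg,
    fun hs p hp => by
    rw [eq_comm, add_comm, @eq_comm _ w'.1, add_comm w'.2]; exact h.cross hs.symm p hp⟩

theorem swap (h : ColorMatched π π' E F f σ τ v w v' w') :
    ColorMatched π' π E F (Prod.swap ⁻¹' f) σ τ v' w' v w :=
  ⟨fun e he => (h.left e he).symm, fun e he => (h.right e he).symm,
    fun hs g hg => (h.same hs g hg).symm, fun hs _ hp => (h.cross hs _ hp).symm⟩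

theorem mono (h : ColorMatched π π' E F f σ τ v w v' w') (hE : E' ⊆ E) (hF : F' ⊆ F)
    {f' : Set (S × S')} (hf : f' ⊆ f) : ColorMatched π π' E' F' f' σ τ v w v' w' :=
  ⟨fun e he => h.left e (hE he), fun e he => h.right e (hE he),
    fun hs g hg => h.same hs g (hF hg), fun hs p hp => h.cross hs p (hf hp)⟩

theorem trans {f' : Set (S' × S'')} {f'' : Set (S × S'')}
    (hf : ∀ p ∈ f'', ∃ b, (p.1, b) ∈ f ∧ (b, p.2) ∈ f')
    (h : ColorMatched π π' E F f σ τ v w v' w') (h' : ColorMatched π' π'' E F f' σ τ v' w' v'' w'') :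
    ColorMatched π π'' E F f'' σ τ v w v'' w'' :=
  ⟨fun e he => (h.left e he).trans (h'.left e he), fun e he => (h.right e he).trans (h'.right e he),
    fun hs g hg => (h.same hs g hg).trans (h'.same hs g hg), fun hs p hp => by
      obtain ⟨b, h1, h2⟩ := hf p hp
      exact (h.cross hs _ h1).trans (h'.cross hs _ h2)⟩

theorem refl {T : Set S} : ColorMatched π π E F ((fun c => (c, c)) '' T) σ τ v w v w :=
  ⟨fun _ _ => Iff.rfl, fun _ _ => Iff.rfl, fun _ _ _ => Iff.rfl, by
    rintro _ _ ⟨c, -, rfl⟩; rfl⟩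

theorem const : ColorMatched π π' E F f σ σ v v v v :=
  ⟨fun _ _ => Iff.rfl, fun _ _ => Iff.rfl, fun _ _ _ => Iff.rfl, fun h => (h rfl).elim⟩

theorem diag (h : ∀ e ∈ E, v.1 = e ↔ v'.1 = e) : ColorMatched π π' E F f σ σ v v v' v' :=
  ⟨h, h, fun _ g _ => by simp [ColorGroup.add_self], fun h => (h rfl).elim⟩

/-- The sets of matched data are finite, and cross colours are matched injectively. -/
structure Admissible (E : Set ℕ) (F : Set ColorGroup) (f : Set (S × S')) : Prop where
  finite_index : E.Finite
  finite_same : F.Finite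
  finite_cross : f.Finite
  eq_iff : ∀ p ∈ f, ∀ q ∈ f, p.1 = q.1 ↔ p.2 = q.2

theorem Admissible.swap (h : Admissible E F f) : Admissible E F (Prod.swap ⁻¹' f) :=
  ⟨h.finite_index, h.finite_same, h.finite_cross.preimage Prod.swap_injective.injOn,
    fun _ hp _ hq => (h.eq_iff _ hp _ hq).symm⟩

theorem Admissible.of_image {T : Set S} (hE : E.Finite) (hF : F.Finite) (hT : T.Finite) :
    Admissible E F ((fun c => (c, c)) '' T) :=
  ⟨hE, hF, hT.image _, by
    rintro _ ⟨c, -, rfl⟩ _ ⟨d, -, rfl⟩; rfl⟩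

theorem exists_index (hE : E.Finite) (v : Val) (I : Set ℕ) (hI : I.Finite)
    (hvI : v.1 ∈ E → v.1 ∉ I) : ∃ i ∉ I, ∀ e ∈ E, v.1 = e ↔ i = e := by
  by_cases hv : v.1 ∈ E
  · exact ⟨v.1, hvI hv, fun _ _ => Iff.rfl⟩
  · obtain ⟨i, hi⟩ := (hE.union hI).exists_notMem
    exact ⟨i, fun h => hi (Or.inr h), fun e he => iff_of_false (fun h => hv (h ▸ he))
      fun h => hi (Or.inl (h ▸ he))⟩

/-- For a single pair there is no triangle of colours to respect: one difference is to be matched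
with one difference, so f need not be compatible with addition. Infinitely many cross colours and
block indices leave room for a choice outside the matched ones. -/
theorem extends_one [Infinite S'] (hπ' : Function.Surjective π') (h : Admissible E F f) :
    Matching.Extends (ColorMatched π π' E F f) 1 := by
  intro P hP hPM σ v
  rcases Finset.card_le_one_iff_subset_singleton.1 hP with ⟨a, ha⟩
  by_cases haP : a ∈ P
  swap
  · refine ⟨v, const, fun b hb => (haP ?_).elim⟩
    rwa [← Finset.mem_singleton.1 (ha hb)]
  obtain ⟨τ, w, w'⟩ := a
  have hw := (hPM _ haP _ haP).left
  simp only at hw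
  suffices H : ∃ v', (∀ e ∈ E, v.1 = e ↔ v'.1 = e) ∧ ColorMatched π π' E F f σ τ v w v' w' by
    obtain ⟨v', h1, h2⟩ := H
    refine ⟨v', diag h1, fun b hb => ?_⟩
    rw [Finset.mem_singleton.1 (ha hb)]
    exact h2
  by_cases hvw : v.1 = w.1
  · have H : ∃ g : ColorGroup, (σ = τ → v.2 + w.2 = g) ∧
        (σ ≠ τ → ∀ p ∈ f, π (v.2 + w.2) = p.1 ↔ π' g = p.2) := by
      by_cases hs : σ = τ
      · exact ⟨_, fun _ => rfl, fun h => (h hs).elim⟩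
      · by_cases hc : ∃ p ∈ f, π (v.2 + w.2) = p.1
        · obtain ⟨p, hp, hc⟩ := hc
          obtain ⟨g, hg⟩ := hπ' p.2
          refine ⟨g, fun h => (hs h).elim, fun _ q hq => ?_⟩
          rw [hc, hg]
          exact h.eq_iff p hp q hq
        -- An unmatched cross colour is answered by any cross colour outside the finite range of f.
        · obtain ⟨c, hc'⟩ := (h.finite_cross.image Prod.snd).exists_notMem
          obtain ⟨g, rfl⟩ := hπ' c
          refine ⟨g, fun h => (hs h).elim, fun _ q hq => iff_of_false (fun h => hc ⟨q, hq, h⟩)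
            fun h => hc' ⟨q, hq, h.symm⟩⟩
    obtain ⟨g, h1, h2⟩ := H
    have hE : ∀ e ∈ E, v.1 = e ↔ w'.1 = e := fun e he => by rw [hvw]; exact hw e he
    refine ⟨(w'.1, w'.2 + g), hE, hE, hw, fun hs c _ => ?_, fun hs p hp => ?_⟩
    · simp [hvw, ColorGroup.add_add_cancel_right, h1 hs]
    · simpa [hvw, ColorGroup.add_add_cancel_right] using h2 hs p hp
  -- Different blocks are answered by different blocks; an index in E has to be kept, and then it
  -- already differs from that of w'.
  · obtain ⟨i, hi, hiE⟩ := exists_index h.finite_index v {w'.1} (Set.finite_singleton _)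
      (fun hv hvw' => hvw ((hw _ hv).2 hvw'.symm).symm)
    exact ⟨(i, 0), hiE, hiE, hw, fun _ _ _ => iff_of_false (fun h => hvw h.1) fun h => hi h.1,
      fun _ _ _ => iff_of_false (fun h => hvw h.1) fun h => hi h.1⟩

/-- Colours in a finite subgroup are matched in families of arbitrary size. -/
theorem extends_subgroup (hE : E.Finite) (H : AddSubgroup ColorGroup)
    (hH : (H : Set ColorGroup).Finite) (N : ℕ) :
    Matching.Extends (ColorMatched id id E H ((fun c => (c, c)) '' (H : Set ColorGroup))) N := by
  intro P _ hPM σ v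
  have hsame : ∀ a ∈ P, ∀ b ∈ P, ∀ g ∈ H, (a.2.1.1 = b.2.1.1 ∧ a.2.1.2 + b.2.1.2 = g) ↔
      (a.2.2.1 = b.2.2.1 ∧ a.2.2.2 + b.2.2.2 = g) := by
    intro a ha b hb g hg
    by_cases hs : a.1 = b.1
    · exact (hPM a ha b hb).same hs g hg
    · exact (hPM a ha b hb).cross hs _ ⟨g, hg, rfl⟩
  suffices hv : ∃ v' : Val, (∀ e ∈ E, v.1 = e ↔ v'.1 = e) ∧ ∀ a ∈ P, ∀ g ∈ H,
      (v.1 = a.2.1.1 ∧ v.2 + a.2.1.2 = g) ↔ (v'.1 = a.2.2.1 ∧ v'.2 + a.2.2.2 = g) by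
    obtain ⟨v', h1, h2⟩ := hv
    refine ⟨v', diag h1, fun a ha => ⟨h1, (hPM a ha a ha).left, fun _ => h2 a ha, ?_⟩⟩
    rintro _ _ ⟨g, hg, rfl⟩
    exact h2 a ha g hg
  -- Lying in the same block with difference in H is an equivalence relation, because H is a
  -- subgroup. If v is equivalent to some value in P, the answer is the same translate of the
  -- partner of that value; otherwise it has to avoid all classes of the partners.
  by_cases hc : ∃ a ∈ P, v.1 = a.2.1.1 ∧ v.2 + a.2.1.2 ∈ H
  · obtain ⟨a, ha, hva, hvH⟩ := hc
    refine ⟨(a.2.2.1, a.2.2.2 + (v.2 + a.2.1.2)), fun e he => by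
      rw [hva]; exact (hPM a ha a ha).left e he, fun b hb g hg => ?_⟩
    have := hsame a ha b hb (g + (v.2 + a.2.1.2)) (H.add_mem hg hvH)
    rw [← hva] at this
    have e1 : ∀ x : ColorGroup, x = g + (v.2 + a.2.1.2) ↔ x + (v.2 + a.2.1.2) = g := by
      intro x
      constructor
      · rintro rfl
        rw [add_assoc, ColorGroup.add_self, add_zero]
      · rintro rfl
        rw [add_assoc, ColorGroup.add_self, add_zero]
    rw [e1, e1] at this
    have e2 : a.2.1.2 + b.2.1.2 + (v.2 + a.2.1.2) = v.2 + b.2.1.2 := by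
      rw [add_comm v.2, add_add_add_comm, ColorGroup.add_self, zero_add, add_comm]
    rw [e2] at this
    rw [this, add_right_comm]
  · have hfalse : ∀ a ∈ P, ∀ g ∈ H, ¬ (v.1 = a.2.1.1 ∧ v.2 + a.2.1.2 = g) :=
      fun a ha g hg h => hc ⟨a, ha, h.1, h.2 ▸ hg⟩
    by_cases hvE : v.1 ∈ E
    -- The block index cannot be changed here, so the colour is taken outside finitely many cosets
    -- of H; this uses that H is finite.
    · obtain ⟨g, hg⟩ := (P.finite_toSet.biUnion fun a _ =>
        hH.image fun h => a.2.2.2 + h).exists_notMem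
      simp only [Set.mem_iUnion, Set.mem_image, not_exists, not_and] at hg
      refine ⟨(v.1, g), fun _ _ => Iff.rfl, fun a ha h hh => iff_of_false (hfalse a ha h hh)
        fun h' => hg a ha h hh ?_⟩
      rw [← h'.2]
      change a.2.2.2 + (g + a.2.2.2) = g
      rw [add_comm g, ColorGroup.add_add_cancel]
    · obtain ⟨i, hi, hiE⟩ := exists_index hE v ((fun a => a.2.2.1) '' (P : Set (Bool × Val × Val)))
        (P.finite_toSet.image _) (fun h => (hvE h).elim)
      exact ⟨(i, 0), hiE, fun a ha g hg => iff_of_false (hfalse a ha g hg)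
        fun h => hi ⟨a, ha, h.1.symm⟩⟩

end ColorMatched

/-! ### The algebras of finitely supported relations -/

/-- Similarity of `m + 2`-tuples of the generic structure. -/
abbrev Sim (m : ℕ) {S S' : Type} (π : ColorGroup → S) (π' : ColorGroup → S') (E : Set ℕ)
    (F : Set ColorGroup) (f : Set (S × S')) (s s' : Fin (m + 2) → Point) : Prop :=
  Matched m Set.univ (ColorMatched π π' E F f) s s'

/-- Two relations correspond to each other along the similarity of tuples. -/
def Corr (m : ℕ) {S S' : Type} (π : ColorGroup → S) (π' : ColorGroup → S') (E : Set ℕ)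
    (F : Set ColorGroup) (f : Set (S × S')) (X Y : Set (Fin (m + 2) → Point)) : Prop :=
  ∀ s s', Sim m π π' E F f s s' → (s ∈ X ↔ s' ∈ Y)

section

variable {m : ℕ} {S S' : Type} {π : ColorGroup → S} {π' : ColorGroup → S'} {E E' : Set ℕ}
  {F F' : Set ColorGroup} {f : Set (S × S')} {s s' t : Fin (m + 2) → Point}
  {X X' Y Y' : Set (Fin (m + 2) → Point)}

open ColorMatched (Admissible)

theorem Sim.swap (h : Sim m π π' E F f s s') : Sim m π' π E F (Prod.swap ⁻¹' f) s' s :=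
  h.symm fun _ _ _ _ _ _ => ColorMatched.swap

theorem Sim.mono (h : Sim m π π' E F f s s') (hE : E' ⊆ E) (hF : F' ⊆ F) {f' : Set (S × S')}
    (hf : f' ⊆ f) : Sim m π π' E' F' f' s s' :=
  Matched.mono (fun _ _ _ _ _ _ h => h.mono hE hF hf) h

theorem Sim.trans {S'' : Type} {π'' : ColorGroup → S''} {f' : Set (S' × S'')} {f'' : Set (S × S'')}
    (h : Sim m π π' E F f s s') (h' : Sim m π' π'' E F f' s' t)
    (hf : ∀ p ∈ f'', ∃ b, (p.1, b) ∈ f ∧ (b, p.2) ∈ f') : Sim m π π'' E F f'' s t :=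
  Matched.trans (M := ColorMatched π π' E F f) (M' := ColorMatched π' π'' E F f')
    (fun _ _ _ _ _ _ _ _ h h' => ColorMatched.trans hf h h') h h'

theorem Sim.self_refl (T : Set S) (s : Fin (m + 2) → Point) :
    Sim m π π E F ((fun c => (c, c)) '' T) s s :=
  Matched.refl (fun _ _ _ _ => ColorMatched.refl) s

theorem Sim.self_symm {T : Set S} (h : Sim m π π E F ((fun c => (c, c)) '' T) s s') :
    Sim m π π E F ((fun c => (c, c)) '' T) s' s := by
  refine h.swap.mono subset_rfl subset_rfl ?_
  rintro _ ⟨c, hc, rfl⟩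
  exact ⟨c, hc, rfl⟩

/-- The count m + 2 = 1 + m + 1 is where the dimension enters: the extension property for N = 1
suffices exactly up to this arity. -/
theorem Sim.exists_forth [Infinite S'] (hπ' : Function.Surjective π') (hf : Admissible E F f)
    (h : Sim m π π' E F f s s') (J : Set (Fin (m + 2))) (hst : ∀ i ∉ J, s i = t i) :
    ∃ t', (∀ i ∉ J, s' i = t' i) ∧ Sim m π π' E F f t t' := by
  have := Matched.exists_forth (D := (Finset.univ : Finset (Fin (m + 2)))) (N := 1) (m := m)
    (M := ColorMatched π π' E F f) (s := s) (s' := s') (t := t) ColorMatched.symm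
    (ColorMatched.extends_one hπ' hf) (by
      rw [Finset.card_univ, Fintype.card_fin]; omega) (by rwa [Finset.coe_univ]) J hst
  rwa [Finset.coe_univ] at this

/-- Start from a constant tuple, which is similar to itself whatever f is, since no cross difference
occurs, and change all places. -/
theorem exists_sim [Infinite S'] (hπ' : Function.Surjective π') (hf : Admissible E F f)
    (s : Fin (m + 2) → Point) : ∃ s', Sim m π π' E F f s s' := by
  obtain ⟨s', -, h⟩ := Sim.exists_forth (m := m) (π := π) hπ' hf
    (Matched.const (fun _ _ => ColorMatched.const) (s 0)) Set.univ (t := s)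
    fun i hi => (hi trivial).elim
  exact ⟨s', h⟩

theorem exists_sim_right [Infinite S] (hπ : Function.Surjective π) (hf : Admissible E F f)
    (s' : Fin (m + 2) → Point) : ∃ s, Sim m π π' E F f s s' := by
  obtain ⟨s, h⟩ := exists_sim (m := m) (π := π') hπ hf.swap s'
  exact ⟨s, h.swap⟩

namespace Corr

theorem mono (h : Corr m π π' E F f X Y) (hE : E ⊆ E') (hF : F ⊆ F') {f' : Set (S × S')}
    (hf : f ⊆ f') : Corr m π π' E' F' f' X Y := fun s s' hs =>
  h s s' (hs.mono hE hF hf)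

theorem swap (h : Corr m π π' E F f X Y) : Corr m π' π E F (Prod.swap ⁻¹' f) Y X :=
  fun s s' hs => (h s' s hs.swap).symm

theorem bot : Corr m π π' E F f ⊥ ⊥ := fun _ _ _ => Iff.rfl

theorem top : Corr m π π' E F f ⊤ ⊤ := fun _ _ _ => Iff.rfl

theorem compl (h : Corr m π π' E F f X Y) : Corr m π π' E F f Xᶜ Yᶜ :=
  fun s s' hs => not_congr (h s s' hs)

theorem inf (h : Corr m π π' E F f X Y) (h' : Corr m π π' E F f X' Y') :
    Corr m π π' E F f (X ⊓ X') (Y ⊓ Y') :=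
  fun s s' hs => and_congr (h s s' hs) (h' s s' hs)

theorem sup (h : Corr m π π' E F f X Y) (h' : Corr m π π' E F f X' Y') :
    Corr m π π' E F f (X ⊔ X') (Y ⊔ Y') :=
  fun s s' hs => or_congr (h s s' hs) (h' s s' hs)

theorem diag (i j : Fin (m + 2)) :
    Corr m π π' E F f (PolyadicEqualityAlgebra.diag i j) (PolyadicEqualityAlgebra.diag i j) :=
  fun _ _ hs => hs.eq_iff i trivial j trivial

theorem sub (h : Corr m π π' E F f X Y) (τ : Fin (m + 2) → Fin (m + 2)) :
    Corr m π π' E F f (PolyadicAlgebra.sub τ X) (PolyadicAlgebra.sub τ Y) :=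
  fun s s' hs => h (s ∘ τ) (s' ∘ τ) (hs.comp τ fun _ _ => trivial)

theorem cyl [Infinite S] [Infinite S'] (hπ : Function.Surjective π) (hπ' : Function.Surjective π')
    (hf : Admissible E F f) (h : Corr m π π' E F f X Y) (J : Set (Fin (m + 2))) :
    Corr m π π' E F f (PolyadicAlgebra.cyl J X) (PolyadicAlgebra.cyl J Y) := by
  intro s s' hs
  constructor
  · rintro ⟨t, ht, hst⟩
    obtain ⟨t', hst', htt'⟩ := hs.exists_forth hπ' hf J hst
    exact ⟨t', (h t t' htt').1 ht, hst'⟩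
  · rintro ⟨t', ht', hst'⟩
    obtain ⟨t, hst, htt'⟩ := hs.swap.exists_forth hπ hf.swap J hst'
    exact ⟨t, (h t t' htt'.swap).2 ht', hst⟩

/-- Similarity is total on both sides, so a relation is determined by its partner. -/
theorem eq_iff [Infinite S] [Infinite S'] (hπ : Function.Surjective π)
    (hπ' : Function.Surjective π') (hf : Admissible E F f) (h : Corr m π π' E F f X Y)
    (h' : Corr m π π' E F f X' Y') : X = X' ↔ Y = Y' := by
  constructor
  · rintro rfl
    ext s'
    obtain ⟨s, hs⟩ := exists_sim_right (m := m) (π' := π') hπ hf s'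
    rw [← h s s' hs, h' s s' hs]
  · rintro rfl
    ext s
    obtain ⟨s', hs⟩ := exists_sim (m := m) (π := π) hπ' hf s
    rw [h s s' hs, h' s s' hs]

end Corr

/-- The relation `X` is supported by finite sets of block indices and of colours. -/
structure Supports (m : ℕ) {S : Type} (π : ColorGroup → S) (E : Set ℕ) (F : Set ColorGroup)
    (T : Set S) (X : Set (Fin (m + 2) → Point)) : Prop where
  finite_index : E.Finite
  finite_same : F.Finite
  finite_cross : T.Finite
  corr : Corr m π π E F ((fun c => (c, c)) '' T) X X

theorem Supports.admissible {T : Set S} (h : Supports m π E F T X) :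
    Admissible E F ((fun c => (c, c)) '' T) :=
  Admissible.of_image h.finite_index h.finite_same h.finite_cross

theorem Supports.union {T T' : Set S} (h : Supports m π E F T X) (h' : Supports m π E' F' T' X') :
    Supports m π (E ∪ E') (F ∪ F') (T ∪ T') X ∧ Supports m π (E ∪ E') (F ∪ F') (T ∪ T') X' := by
  have hE := h.finite_index.union h'.finite_index
  have hF := h.finite_same.union h'.finite_same
  have hT := h.finite_cross.union h'.finite_cross
  exact ⟨⟨hE, hF, hT, h.corr.mono Set.subset_union_left Set.subset_union_left
    (Set.image_mono Set.subset_union_left)⟩,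
    ⟨hE, hF, hT, h'.corr.mono Set.subset_union_right Set.subset_union_right
    (Set.image_mono Set.subset_union_right)⟩⟩

/-- The set algebra of all finitely supported relations, where the colours of pairs of points of
different sorts are identified along `π`. -/
def supportedAlgebra (m : ℕ) {S : Type} [Infinite S] (π : ColorGroup → S)
    (hπ : Function.Surjective π) : SetPEA (Fin (m + 2)) Point where
  carrier := {X | ∃ E F T, Supports m π E F T X}
  supClosed' := by
    rintro X ⟨E, F, T, h⟩ Y ⟨E', F', T', h'⟩
    obtain ⟨h1, h2⟩ := h.union h'
    exact ⟨_, _, _, h1.1, h1.2, h1.3, h1.4.sup h2.4⟩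
  infClosed' := by
    rintro X ⟨E, F, T, h⟩ Y ⟨E', F', T', h'⟩
    obtain ⟨h1, h2⟩ := h.union h'
    exact ⟨_, _, _, h1.1, h1.2, h1.3, h1.4.inf h2.4⟩
  compl_mem' := by
    rintro X ⟨E, F, T, h⟩
    exact ⟨_, _, _, h.1, h.2, h.3, h.4.compl⟩
  bot_mem' := ⟨∅, ∅, ∅, Set.finite_empty, Set.finite_empty, Set.finite_empty, Corr.bot⟩
  cyl_mem := by
    rintro J X ⟨E, F, T, h⟩
    exact ⟨_, _, _, h.1, h.2, h.3, h.4.cyl hπ hπ h.admissible J⟩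
  sub_mem := by
    rintro τ X ⟨E, F, T, h⟩
    exact ⟨_, _, _, h.1, h.2, h.3, h.4.sub τ⟩
  diag_mem i j := ⟨∅, ∅, ∅, Set.finite_empty, Set.finite_empty, Set.finite_empty, Corr.diag i j⟩

/-! ### Atomicity -/

open Classical in
/-- Tuples similar with respect to all block indices and colours occurring in the first one are
similar with respect to all of them. -/
theorem exists_finite_sim (m : ℕ) (π : ColorGroup → S) (s : Fin (m + 2) → Point) :
    ∃ (E : Set ℕ) (F : Set ColorGroup) (T : Set S), E.Finite ∧ F.Finite ∧ T.Finite ∧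
      ∀ s', Sim m π π E F ((fun c => (c, c)) '' T) s s' →
        Sim m π π Set.univ Set.univ ((fun c => (c, c)) '' Set.univ) s s' := by
  let V : Set Val := Set.range fun p : Fin (m + 2) × (Fin m → Fin (m + 2)) =>
    Point.val (s p.1) (s ∘ p.2)
  have hV : V.Finite := Set.finite_range _
  have hmem : ∀ i k, Point.val (s i) (s ∘ k) ∈ V := fun i k => ⟨(i, k), rfl⟩
  -- Sums are collected regardless of sorts; the excess is finite and harmless.
  refine ⟨Prod.fst '' V, Set.image2 (fun v w : Val => v.2 + w.2) V V,
    Set.image2 (fun v w : Val => π (v.2 + w.2)) V V, hV.image _, hV.image2 _ hV, hV.image2 _ hV,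
    fun s' h => ⟨h.eq_iff, h.sort_eq, fun k hk hinj i hi j hj hi' hj' => ?_⟩⟩
  have h0 := h.matching k hk hinj i hi j hj hi' hj'
  have hvi := hmem i k
  have hvj := hmem j k
  have h1 := (h0.left _ ⟨_, hvi, rfl⟩).1 rfl
  have h2 := (h0.right _ ⟨_, hvj, rfl⟩).1 rfl
  refine ⟨fun e _ => by rw [h1], fun e _ => by rw [h2], fun hs g _ => ?_, ?_⟩
  · have h3 := h0.same hs _ (Set.mem_image2_of_mem hvi hvj)
    rw [h1, h2] at h3 ⊢
    refine and_congr_right fun hij => ?_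
    rw [(h3.1 ⟨hij, by trivial⟩).2]
  · rintro hs _ ⟨c, -, rfl⟩
    have h3 := h0.cross hs _ ⟨_, Set.mem_image2_of_mem hvi hvj, rfl⟩
    simp only at h3 ⊢
    rw [h1, h2] at h3 ⊢
    refine and_congr_right fun hij => ?_
    rw [(h3.1 ⟨hij, by trivial⟩).2]

/-- The atom below X is the similarity class of one of its tuples s, taken over the values occurring
in s. By `exists_finite_sim` members of this class are similar to s over every support, so each
element of the algebra that contains s contains the class. -/
theorem isAtomic_supportedAlgebra [Infinite S] (hπ : Function.Surjective π) :
    IsAtomic (supportedAlgebra m π hπ).Carrier := by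
  refine ⟨fun X => or_iff_not_imp_left.2 fun hX => ?_⟩
  obtain ⟨s, hs⟩ : X.1.Nonempty := by
    rw [Set.nonempty_iff_ne_empty]
    exact fun h => hX (Subtype.ext h)
  obtain ⟨E, F, T, hE, hF, hT, hall⟩ := exists_finite_sim m π s
  have hY : ∀ Y : (supportedAlgebra m π hπ).Carrier, s ∈ Y.1 →
      ∀ t, Sim m π π E F ((fun c => (c, c)) '' T) s t → t ∈ Y.1 := by
    rintro ⟨Y, E', F', T', hY⟩ hsY t hst
    exact (hY.corr s t ((hall t hst).mono (Set.subset_univ _) (Set.subset_univ _)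
      (Set.image_mono (Set.subset_univ _)))).1 hsY
  have htr : ∀ {r t u}, Sim m π π E F ((fun c => (c, c)) '' T) r t →
      Sim m π π E F ((fun c => (c, c)) '' T) t u → Sim m π π E F ((fun c => (c, c)) '' T) r u :=
    fun h h' => h.trans h' (by
      rintro _ ⟨c, hc, rfl⟩
      exact ⟨c, ⟨c, hc, rfl⟩, ⟨c, hc, rfl⟩⟩)
  let Z : (supportedAlgebra m π hπ).Carrier :=
    ⟨{t | Sim m π π E F ((fun c => (c, c)) '' T) s t}, E, F, T, hE, hF, hT, fun r t hrt =>
      ⟨fun h => htr h hrt, fun h => htr h hrt.self_symm⟩⟩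
  refine ⟨Z, ⟨fun h => ?_, fun Y hYZ => ?_⟩, fun t ht => hY X hs t ht⟩
  · have : s ∈ Z.1 := Sim.self_refl T s
    rw [h] at this
    exact this
  · by_contra hne
    obtain ⟨t, ht⟩ : Y.1.Nonempty := by
      rw [Set.nonempty_iff_ne_empty]
      exact fun h => hne (Subtype.ext h)
    have hst : Sim m π π E F ((fun c => (c, c)) '' T) s t := hYZ.le ht
    refine hYZ.not_ge fun r hr => ?_
    by_contra hrY
    exact hY (Yᶜ) (fun hsY => hrY (hY Y hsY r hr)) t hst ht

/-! ### Equivalence of the algebras -/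

/-- Each cross colour outside the domain is sent to one outside the finite range, so f stays
injective in both directions. -/
theorem exists_admissible_superset [Infinite S'] (hf : Admissible E F f) (hE : E'.Finite)
    (hF : F'.Finite) {T : Set S} (hT : T.Finite) :
    ∃ f', f ⊆ f' ∧ T ⊆ Prod.fst '' f' ∧ Admissible (E ∪ E') (F ∪ F') f' := by
  induction T, hT using Set.Finite.induction_on with
  | empty =>
    exact ⟨f, subset_rfl, Set.empty_subset _, hf.1.union hE, hf.2.union hF, hf.3, hf.4⟩
  | @insert c T _ _ ih =>
    obtain ⟨f', hff', hTf', hf'⟩ := ih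
    by_cases hc : c ∈ Prod.fst '' f'
    · exact ⟨f', hff', Set.insert_subset hc hTf', hf'⟩
    · obtain ⟨d, hd⟩ := (hf'.finite_cross.image Prod.snd).exists_notMem
      have hcd : ∀ p ∈ f', c = p.1 ↔ d = p.2 := fun p hp =>
        iff_of_false (fun h => hc ⟨p, hp, h.symm⟩) fun h => hd ⟨p, hp, h.symm⟩
      refine ⟨insert (c, d) f', hff'.trans (Set.subset_insert _ _), ?_, hf'.1, hf'.2,
        hf'.3.insert _, ?_⟩
      · rw [Set.image_insert_eq]
        exact Set.insert_subset_insert hTf'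
      · rintro p (rfl | hp) q (rfl | hq)
        · exact iff_of_true rfl rfl
        · exact hcd q hq
        · rw [eq_comm, @eq_comm _ p.2]; exact hcd p hp
        · exact hf'.4 p hp q hq

/-- The partner of X is its image under similarity, after f has been extended to the cross colours
in the support of X. Two tuples similar to a common tuple are then similar over the support of X, so
the image corresponds to X exactly; its own support is the range of the extended matching. -/
theorem Corr.exists_extension [Infinite S] [Infinite S'] (hπ : Function.Surjective π)
    (hπ' : Function.Surjective π') (hf : Admissible E F f)
    (X : (supportedAlgebra m π hπ).Carrier) :
    ∃ E' F' f', E ⊆ E' ∧ F ⊆ F' ∧ f ⊆ f' ∧ Admissible E' F' f' ∧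
      ∃ Y : (supportedAlgebra m π' hπ').Carrier, Corr m π π' E' F' f' X.1 Y.1 := by
  obtain ⟨X, E₀, F₀, T₀, hX⟩ := X
  obtain ⟨f', hff', hTf', hf'⟩ := exists_admissible_superset hf hX.1 hX.2 hX.3
  have hback : ∀ {s t r}, Sim m π π' (E ∪ E₀) (F ∪ F₀) f' s r → Sim m π π' (E ∪ E₀) (F ∪ F₀) f' t r →
      Sim m π π E₀ F₀ ((fun c => (c, c)) '' T₀) s t := fun h h' =>
    (h.trans (f'' := (fun c => (c, c)) '' T₀) h'.swap (by
      rintro _ ⟨c, hc, rfl⟩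
      obtain ⟨p, hp, rfl⟩ := hTf' hc
      exact ⟨p.2, hp, hp⟩)).mono Set.subset_union_right Set.subset_union_right subset_rfl
  have hforth : ∀ {s r r'}, Sim m π π' (E ∪ E₀) (F ∪ F₀) f' s r →
      Sim m π' π' (E ∪ E₀) (F ∪ F₀) ((fun c => (c, c)) '' (Prod.snd '' f')) r r' →
      Sim m π π' (E ∪ E₀) (F ∪ F₀) f' s r' := fun h h' =>
    h.trans h' fun p hp => ⟨p.2, hp, p.2, ⟨p, hp, rfl⟩, rfl⟩
  refine ⟨_, _, f', Set.subset_union_left, Set.subset_union_left, hff', hf',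
    ⟨{r | ∃ s ∈ X, Sim m π π' (E ∪ E₀) (F ∪ F₀) f' s r}, E ∪ E₀, F ∪ F₀, Prod.snd '' f', hf'.1, hf'.2,
      hf'.3.image _, ?_⟩, ?_⟩
  · rintro r r' hrr'
    constructor
    · rintro ⟨s, hs, hsr⟩
      exact ⟨s, hs, hforth hsr hrr'⟩
    · rintro ⟨s, hs, hsr⟩
      exact ⟨s, hs, hforth hsr hrr'.self_symm⟩
  · intro s r hsr
    constructor
    · exact fun hs => ⟨s, hs, hsr⟩
    · rintro ⟨t, ht, htr⟩
      exact (hX.corr t s (hback htr hsr)).1 ht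

/-- The system of all correspondences between two algebras of finitely supported relations. -/
def corrSystem (m : ℕ) [Infinite S] [Infinite S'] (hπ : Function.Surjective π)
    (hπ' : Function.Surjective π') :
    Set ((supportedAlgebra m π hπ).Carrier → (supportedAlgebra m π' hπ').Carrier → Prop) :=
  {R | ∃ E F f, Admissible E F f ∧ R = fun X Y => Corr m π π' E F f X.1 Y.1}

theorem corrSystem_nonempty [Infinite S] [Infinite S'] (hπ : Function.Surjective π)
    (hπ' : Function.Surjective π') : (corrSystem m hπ hπ').Nonempty :=
  ⟨_, ∅, ∅, ∅, ⟨Set.finite_empty, Set.finite_empty, Set.finite_empty, by simp⟩, rfl⟩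

theorem backAndForth_corrSystem [Infinite S] [Infinite S'] (hπ : Function.Surjective π)
    (hπ' : Function.Surjective π') :
    BackAndForth (peaLanguage (Fin (m + 2))) (corrSystem m hπ hπ') where
  isPartialIso := by
    rintro _ ⟨E, F, f, hf, rfl⟩
    refine ⟨fun {k} G x y hxy => ?_, fun r => r.elim, fun {X X' Y Y'} h h' => ?_⟩
    · rcases G with _ | _ | ⟨i, j⟩ | _ | J | τ | _ | _
      · exact Corr.bot
      · exact Corr.top
      · exact Corr.diag i j
      · exact (hxy 0).compl
      · exact (hxy 0).cyl hπ hπ' hf J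
      · exact (hxy 0).sub τ
      · exact (hxy 0).inf (hxy 1)
      · exact (hxy 0).sup (hxy 1)
    · rw [Subtype.ext_iff, Subtype.ext_iff]
      exact Corr.eq_iff hπ hπ' hf h h'
  forth := by
    rintro _ ⟨E, F, f, hf, rfl⟩ X
    obtain ⟨E', F', f', hE, hF, hff, hf', Y, hXY⟩ := Corr.exists_extension hπ hπ' hf X
    exact ⟨_, ⟨E', F', f', hf', rfl⟩, fun _ _ h => Corr.mono h hE hF hff, Y, hXY⟩
  back := by
    rintro _ ⟨E, F, f, hf, rfl⟩ Y
    obtain ⟨E', F', f', hE, hF, hff, hf', X, hXY⟩ := Corr.exists_extension hπ' hπ hf.swap Y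
    exact ⟨_, ⟨E', F', Prod.swap ⁻¹' f', hf'.swap, rfl⟩,
      fun _ _ h => Corr.mono h hE hF fun p hp => hff (by simpa using hp), X, hXY.swap⟩

end

/-! ### The `ω`-dimensional algebra -/

/-- The group has exponent two, so the subgroup lies in a finite-dimensional vector space over the
field with two elements. -/
theorem ColorGroup.finite_closure {F : Set ColorGroup} (hF : F.Finite) :
    (AddSubgroup.closure F : Set ColorGroup).Finite := by
  have : Module.Finite (ZMod 2) (Submodule.span (ZMod 2) F) := Module.Finite.span_of_finite _ hF
  have : Finite (Submodule.span (ZMod 2) F) := Module.finite_of_finite (ZMod 2)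
  have hle : AddSubgroup.closure F ≤ (Submodule.span (ZMod 2) F).toAddSubgroup :=
    (AddSubgroup.closure_le _).2 Submodule.subset_span
  exact (Set.toFinite (Submodule.span (ZMod 2) F : Set ColorGroup)).subset hle

/-- Matching of block indices in `E` and of all colours in the subgroup generated by `F`. -/
abbrev spanMatching (E : Set ℕ) (F : Set ColorGroup) : Matching :=
  ColorMatched id id E (AddSubgroup.closure F)
    ((fun c => (c, c)) '' (AddSubgroup.closure F : Set ColorGroup))

theorem spanMatching_mono {E E' : Set ℕ} {F F' : Set ColorGroup} (hE : E ⊆ E') (hF : F ⊆ F')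
    ⦃σ τ v w v' w'⦄ (h : spanMatching E' F' σ τ v w v' w') : spanMatching E F σ τ v w v' w' :=
  h.mono hE (AddSubgroup.closure_mono hF) (Set.image_mono (AddSubgroup.closure_mono hF))

theorem spanMatching_swap {E : Set ℕ} {F : Set ColorGroup} ⦃σ τ v w v' w'⦄
    (h : spanMatching E F σ τ v w v' w') : spanMatching E F σ τ v' w' v w := by
  refine h.swap.mono subset_rfl subset_rfl ?_
  rintro _ ⟨c, hc, rfl⟩
  exact ⟨c, hc, rfl⟩

/-- A relation of infinite arity depending on finitely many places, and on finitely many block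
indices and colours. -/
structure LocallySupports (m : ℕ) (D : Finset ℕ) (E : Set ℕ) (F : Set ColorGroup)
    (Y : Set (ℕ → Point)) : Prop where
  finite_index : E.Finite
  finite_same : F.Finite
  mem_iff : ∀ s s', Matched m (D : Set ℕ) (spanMatching E F) s s' → (s ∈ Y ↔ s' ∈ Y)

theorem LocallySupports.union {m : ℕ} {D D' : Finset ℕ} {E E' : Set ℕ} {F F' : Set ColorGroup}
    {Y Y' : Set (ℕ → Point)} (h : LocallySupports m D E F Y) (h' : LocallySupports m D' E' F' Y') :
    LocallySupports m (D ∪ D') (E ∪ E') (F ∪ F') Y ∧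
      LocallySupports m (D ∪ D') (E ∪ E') (F ∪ F') Y' := by
  have hE := h.finite_index.union h'.finite_index
  have hF := h.finite_same.union h'.finite_same
  refine ⟨⟨hE, hF, fun s s' hs => h.mem_iff s s' ?_⟩, ⟨hE, hF, fun s s' hs => h'.mem_iff s s' ?_⟩⟩
  · exact (hs.mono_index (by simp)).mono
      (spanMatching_mono Set.subset_union_left Set.subset_union_left)
  · exact (hs.mono_index (by simp)).mono
      (spanMatching_mono Set.subset_union_right Set.subset_union_right)

/-- The `ω`-dimensional set algebra of all locally finitely supported relations. -/
def omegaAlgebra (m : ℕ) : SetPEA ℕ Point where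
  carrier := {Y | ∃ D E F, LocallySupports m D E F Y}
  supClosed' := by
    rintro X ⟨D, E, F, h⟩ Y ⟨D', E', F', h'⟩
    obtain ⟨h1, h2⟩ := h.union h'
    exact ⟨_, _, _, h1.1, h1.2, fun s s' hs => or_congr (h1.3 s s' hs) (h2.3 s s' hs)⟩
  infClosed' := by
    rintro X ⟨D, E, F, h⟩ Y ⟨D', E', F', h'⟩
    obtain ⟨h1, h2⟩ := h.union h'
    exact ⟨_, _, _, h1.1, h1.2, fun s s' hs => and_congr (h1.3 s s' hs) (h2.3 s s' hs)⟩
  compl_mem' := by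
    rintro X ⟨D, E, F, h⟩
    exact ⟨_, _, _, h.1, h.2, fun s s' hs => not_congr (h.3 s s' hs)⟩
  bot_mem' := ⟨∅, ∅, ∅, Set.finite_empty, Set.finite_empty, fun _ _ _ => Iff.rfl⟩
  cyl_mem := by
    rintro J X ⟨D, E, F, h⟩
    have key : ∀ s s', Matched m (D : Set ℕ) (spanMatching E F) s s' →
        s ∈ (PolyadicAlgebra.cyl J X : Set (ℕ → Point)) →
        s' ∈ (PolyadicAlgebra.cyl J X : Set (ℕ → Point)) := by
      rintro s s' hs ⟨t, ht, hst⟩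
      -- A crude bound on the number of points is enough, since subgroup matchings extend families
      -- of every size.
      obtain ⟨t', hst', htt'⟩ := hs.exists_forth (N := D.card) ColorMatched.symm
        (ColorMatched.extends_subgroup h.1 _ (ColorGroup.finite_closure h.2) _) (by omega) J hst
      exact ⟨t', (h.3 t t' htt').1 ht, hst'⟩
    exact ⟨D, E, F, h.1, h.2, fun s s' hs => ⟨key s s' hs, key s' s (hs.symm spanMatching_swap)⟩⟩
  sub_mem := by
    classical
    rintro τ X ⟨D, E, F, h⟩
    refine ⟨D.image τ, E, F, h.1, h.2, fun s s' hs => h.3 _ _ (hs.comp τ fun i hi => ?_)⟩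
    exact Finset.mem_coe.2 (Finset.mem_image_of_mem τ hi)
  diag_mem i j := ⟨{i, j}, ∅, ∅, Set.finite_empty, Set.finite_empty, fun s s' hs =>
    hs.eq_iff i (by simp) j (by simp)⟩

/-- A retraction of `ℕ` onto an initial segment. -/
def retraction (m : ℕ) (k : ℕ) : Fin (m + 2) := if h : k < m + 2 then ⟨k, h⟩ else 0

theorem retraction_val (m : ℕ) (i : Fin (m + 2)) : retraction m i = i := by
  simp [retraction]

theorem val_retraction {m k : ℕ} (h : k < m + 2) : (retraction m k : ℕ) = k := by
  simp [retraction, h]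

/-- The embedding of the finite-dimensional algebra into the `ω`-dimensional one. -/
def neatMap (m : ℕ) (X : (supportedAlgebra m (id : ColorGroup → ColorGroup)
    Function.surjective_id).Carrier) : (omegaAlgebra m).Carrier :=
  ⟨{s | s ∘ Fin.valEmbedding ∈ X.1}, by
    obtain ⟨X, E, F, T, h⟩ := X
    -- Differences within a sort and cross colours are merged into one generating set, which makes
    -- sense because π = id.
    refine ⟨Finset.range (m + 2), E, F ∪ T, h.1, h.2.union h.3, fun s s' hs => h.4 _ _ ?_⟩
    have hF : F ⊆ AddSubgroup.closure (F ∪ T) :=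
      Set.subset_union_left.trans AddSubgroup.subset_closure
    have hT : T ⊆ AddSubgroup.closure (F ∪ T) :=
      Set.subset_union_right.trans AddSubgroup.subset_closure
    exact Sim.mono (hs.comp Fin.valEmbedding fun i _ => by simp) subset_rfl hF (Set.image_mono hT)⟩

theorem mem_neatMap {m : ℕ} {X : (supportedAlgebra m (id : ColorGroup → ColorGroup)
    Function.surjective_id).Carrier} {s : ℕ → Point} :
    s ∈ (neatMap m X).1 ↔ s ∘ Fin.valEmbedding ∈ X.1 := Iff.rfl

/-- The essential point is surjectivity: a relation of arity ω that is closed under changes beyond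
the first m + 2 places is determined by these places, and its trace on them is still finitely
supported. -/
theorem isNeatReductIso_neatMap (m : ℕ) :
    IsNeatReductIso (Fin.valEmbedding : Fin (m + 2) ↪ ℕ) (neatMap m) where
  injective X Y h := by
    refine Subtype.ext (Set.ext fun s => ?_)
    have h1 : s ∘ retraction m ∈ (neatMap m X).1 ↔ s ∘ retraction m ∈ (neatMap m Y).1 := by rw [h]
    have h2 : (s ∘ retraction m) ∘ Fin.valEmbedding = s :=
      funext fun i => congrArg s (retraction_val m i)
    rwa [mem_neatMap, mem_neatMap, h2] at h1
  range_eq := by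
    ext Y
    constructor
    · rintro ⟨X, rfl⟩
      refine Subtype.ext (Set.ext fun s => ⟨?_, fun hs => ⟨s, hs, fun _ _ => rfl⟩⟩)
      rintro ⟨t, ht, hst⟩
      have : s ∘ Fin.valEmbedding = t ∘ (Fin.valEmbedding : Fin (m + 2) ↪ ℕ) :=
        funext fun i => hst _ fun h => h ⟨i, rfl⟩
      rwa [mem_neatMap, this]
    · obtain ⟨Y, D, E, F, h⟩ := Y
      intro hY
      -- Later places are filled with a copy of place 0. The support is the whole generated
      -- subgroup, which is still finite.
      refine ⟨⟨{s | s ∘ retraction m ∈ Y}, E, AddSubgroup.closure F, AddSubgroup.closure F, h.1,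
        ColorGroup.finite_closure h.2, ColorGroup.finite_closure h.2, fun s s' hs =>
        h.3 _ _ (hs.comp _ fun _ _ => trivial)⟩, Subtype.ext (Set.ext fun s => ?_)⟩
      have key : ∀ {s t : ℕ → Point}, (∀ i < m + 2, s i = t i) → t ∈ Y → s ∈ Y := by
        intro s t hst ht
        have hmem : s ∈ (PolyadicAlgebra.cyl (Set.range (Fin.valEmbedding : Fin (m + 2) ↪ ℕ))ᶜ
            (⟨Y, D, E, F, h⟩ : (omegaAlgebra m).Carrier) : (omegaAlgebra m).Carrier).1 := by
          refine ⟨t, ht, fun i hi => ?_⟩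
          rw [Set.notMem_compl_iff] at hi
          obtain ⟨j, rfl⟩ := hi
          exact hst _ j.2
        rwa [show PolyadicAlgebra.cyl (Set.range (Fin.valEmbedding : Fin (m + 2) ↪ ℕ))ᶜ
            (⟨Y, D, E, F, h⟩ : (omegaAlgebra m).Carrier) = _ from hY] at hmem
      have hs : ∀ i < m + 2, ((s ∘ Fin.valEmbedding) ∘ retraction m) i = s i := fun i hi =>
        congrArg s (val_retraction hi)
      exact ⟨fun h => key (fun i hi => (hs i hi).symm) h, fun h => key hs h⟩
  map_sup _ _ := rfl
  map_compl _ := rfl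
  map_cyl J X := by
    classical
    refine Subtype.ext (Set.ext fun s => ⟨?_, ?_⟩)
    · rintro ⟨t, ht, hst⟩
      refine ⟨fun k => if k ∈ (Fin.valEmbedding : Fin (m + 2) ↪ ℕ) '' J then t (retraction m k)
        else s k, ?_, fun k hk => by simp only [hk, if_false]⟩
      have : (fun k => if k ∈ (Fin.valEmbedding : Fin (m + 2) ↪ ℕ) '' J then t (retraction m k)
          else s k) ∘ Fin.valEmbedding = t := by
        funext i
        by_cases hi : i ∈ J
        · have : Fin.valEmbedding i ∈ (Fin.valEmbedding : Fin (m + 2) ↪ ℕ) '' J := ⟨i, hi, rfl⟩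
          simp only [Function.comp_apply, this, if_true]
          exact congrArg t (retraction_val m i)
        · have : Fin.valEmbedding i ∉ (Fin.valEmbedding : Fin (m + 2) ↪ ℕ) '' J := by
            rintro ⟨j, hj, hji⟩
            exact hi (Fin.valEmbedding.injective hji ▸ hj)
          simp only [Function.comp_apply, this, if_false]
          exact hst i hi
      rw [mem_neatMap, this]
      exact ht
    · rintro ⟨t, ht, hst⟩
      refine ⟨_, ht, fun i hi => hst _ ?_⟩
      rintro ⟨j, hj, hji⟩
      exact hi (Fin.valEmbedding.injective hji ▸ hj)
  map_sub τ X := by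
    refine Subtype.ext (Set.ext fun s => ?_)
    rw [mem_neatMap, SetPEA.mem_sub, SetPEA.mem_sub, mem_neatMap]
    have : (s ∘ Function.extend Fin.valEmbedding (Fin.valEmbedding ∘ τ) id) ∘ Fin.valEmbedding =
        (s ∘ Fin.valEmbedding) ∘ τ :=
      funext fun i => congrArg s (Fin.valEmbedding.injective.extend_apply _ _ i)
    rw [this]

theorem inNrPEA_supportedAlgebra (m : ℕ) :
    InNrPEA.{0} (Fin.valEmbedding : Fin (m + 2) ↪ ℕ) (supportedAlgebra m
      (id : ColorGroup → ColorGroup) Function.surjective_id).Carrier :=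
  ⟨(omegaAlgebra m).Carrier, inferInstance, inferInstance, neatMap m, isNeatReductIso_neatMap m,
    fun _ _ => rfl⟩

theorem InNrPEA.inNrPA {ι κ : Type} {e : ι ↪ κ} {A : Type v} [BooleanAlgebra A]
    [PolyadicEqualityAlgebra ι A] (h : InNrPEA.{u} e A) : InNrPA.{u} e A := by
  obtain ⟨C, hC, hC', f, hf, -⟩ := h
  exact ⟨C, hC, hC'.toPolyadicAlgebra, f, hf⟩

/-! ### Composition in neat reducts -/

namespace PolyadicAlgebra

variable {κ : Type u} {C : Type v} [BooleanAlgebra C] [PolyadicAlgebra κ C]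

theorem sub_inf (τ : κ → κ) (x y : C) : sub τ (x ⊓ y) = sub τ x ⊓ sub τ y := by
  rw [← compl_compl (x ⊓ y), compl_inf, sub_compl, sub_sup, sub_compl, sub_compl, compl_sup,
    compl_compl, compl_compl]

theorem sub_mono (τ : κ → κ) {x y : C} (h : x ≤ y) : sub τ x ≤ sub τ y := by
  rw [← inf_eq_left, ← sub_inf, inf_eq_left.2 h]

theorem sub_bot (τ : κ → κ) : sub τ (⊥ : C) = ⊥ := by
  have h := sub_inf τ (⊥ : C) ⊥ᶜ
  rwa [sub_compl, inf_compl_eq_bot, inf_compl_eq_bot] at h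

theorem sub_swap_swap [DecidableEq κ] (i j : κ) (x : C) :
    sub (Equiv.swap i j) (sub (Equiv.swap i j) x) = x := by
  rw [sub_sub, ← Equiv.Perm.coe_mul, Equiv.swap_mul_self, Equiv.Perm.coe_one, sub_id]

theorem sub_swap_eq_bot_iff [DecidableEq κ] (i j : κ) (x : C) :
    sub (Equiv.swap i j) x = ⊥ ↔ x = ⊥ := by
  constructor
  · intro h
    rw [← sub_swap_swap i j x, h, sub_bot]
  · rintro rfl
    exact sub_bot _

theorem cyl_eq_bot_iff (J : Set κ) (x : C) : cyl J x = ⊥ ↔ x = ⊥ :=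
  ⟨fun h => le_bot_iff.1 (h ▸ le_cyl J x), fun h => by rw [h, cyl_bot]⟩

theorem cyl_idem (J : Set κ) (x : C) : cyl J (cyl J x) = cyl J x := by
  rw [cyl_cyl, Set.union_self]

theorem cyl_mono (J : Set κ) {x y : C} (h : x ≤ y) : cyl J x ≤ cyl J y := by
  have := cyl_inf_cyl J x y
  rw [inf_eq_left.2 (h.trans (le_cyl J y))] at this
  exact inf_eq_left.1 this.symm

theorem cyl_inf_cyl_of_eq {J : Set κ} (x : C) {y : C} (hy : cyl J y = y) :
    cyl J (x ⊓ y) = cyl J x ⊓ y := by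
  have := cyl_inf_cyl J x y
  rwa [hy] at this

end PolyadicAlgebra

namespace IsNeatReductIso

open PolyadicAlgebra (sub cyl)

open Equiv (swap)

variable {m : ℕ} {B : Type v} {C : Type w} [BooleanAlgebra B] [PolyadicAlgebra (Fin (m + 2)) B]
  [BooleanAlgebra C] [PolyadicAlgebra (Fin (m + 2 + 1)) C] {f : B → C}

theorem map_inf {ι κ : Type} {e : ι ↪ κ} [PolyadicAlgebra ι B] [PolyadicAlgebra κ C]
    (hf : IsNeatReductIso e f) (x y : B) : f (x ⊓ y) = f x ⊓ f y := by
  rw [← compl_compl (x ⊓ y), compl_inf, hf.map_compl, hf.map_sup, hf.map_compl, hf.map_compl,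
    compl_sup, compl_compl, compl_compl]

theorem map_mono {ι κ : Type} {e : ι ↪ κ} [PolyadicAlgebra ι B] [PolyadicAlgebra κ C]
    (hf : IsNeatReductIso e f) {x y : B} (h : x ≤ y) : f x ≤ f y := by
  rw [← inf_eq_left, ← hf.map_inf, inf_eq_left.2 h]

theorem le_of_map_le {ι κ : Type} {e : ι ↪ κ} [PolyadicAlgebra ι B] [PolyadicAlgebra κ C]
    (hf : IsNeatReductIso e f) {x y : B} (h : f x ≤ f y) : x ≤ y := by
  rw [← inf_eq_left, ← hf.map_inf] at h
  exact inf_eq_left.1 (hf.injective h)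

theorem map_bot {ι κ : Type} {e : ι ↪ κ} [PolyadicAlgebra ι B] [PolyadicAlgebra κ C]
    (hf : IsNeatReductIso e f) : f ⊥ = ⊥ := by
  have h := hf.map_inf (⊥ : B) ⊥ᶜ
  rwa [hf.map_compl, inf_compl_eq_bot, inf_compl_eq_bot] at h

theorem map_eq_bot_iff {ι κ : Type} {e : ι ↪ κ} [PolyadicAlgebra ι B] [PolyadicAlgebra κ C]
    (hf : IsNeatReductIso e f) (x : B) : f x = ⊥ ↔ x = ⊥ := by
  rw [← hf.map_bot, hf.injective.eq_iff]

variable (hf : IsNeatReductIso (Fin.castSuccEmb : Fin (m + 2) ↪ Fin (m + 2 + 1)) f)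
include hf

theorem range_eq_last : Set.range f = {x | cyl {Fin.last (m + 2)} x = x} := by
  have : (Set.range (Fin.castSuccEmb : Fin (m + 2) ↪ Fin (m + 2 + 1)))ᶜ = {Fin.last (m + 2)} := by
    ext i
    refine Fin.lastCases ?_ (fun j => ?_) i
    · simp
    · simp [Fin.castSucc_ne_last]
  rw [hf.range_eq, this]

theorem cyl_last (x : B) : cyl {Fin.last (m + 2)} (f x) = f x := by
  have : f x ∈ Set.range f := ⟨x, rfl⟩
  rwa [hf.range_eq_last] at this

/-- Elements coming from the neat reduct are closed under cylindrification of the last place, so the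
value of a transformation there is irrelevant. -/
theorem sub_congr {σ τ : Fin (m + 2 + 1) → Fin (m + 2 + 1)} (x : B)
    (h : ∀ i : Fin (m + 2), σ i.castSucc = τ i.castSucc) : sub σ (f x) = sub τ (f x) := by
  rw [← hf.cyl_last x]
  refine PolyadicAlgebra.sub_cyl_congr _ _ _ _ fun i hi => ?_
  induction i using Fin.lastCases with
  | last => exact (hi rfl).elim
  | cast i => exact h i

theorem sub_congr_of_cyl {σ τ : Fin (m + 2 + 1) → Fin (m + 2 + 1)} {x : B} {j : Fin (m + 2)}
    (hx : cyl {j} x = x) (h : ∀ i : Fin (m + 2), i ≠ j → σ i.castSucc = τ i.castSucc) :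
    sub σ (f x) = sub τ (f x) := by
  let σ' := Function.update σ j.castSucc (τ j.castSucc)
  have h1 : sub σ (f x) = sub σ' (f x) := by
    rw [← hx, hf.map_cyl]
    refine PolyadicAlgebra.sub_cyl_congr _ _ _ _ fun i hi => ?_
    refine (Function.update_of_ne ?_ ..).symm
    rintro rfl
    exact hi ⟨j, rfl, rfl⟩
  rw [h1]
  refine hf.sub_congr x fun i => ?_
  by_cases hij : i = j
  · subst hij
    exact Function.update_self ..
  · rw [← h i hij]
    exact Function.update_of_ne (fun h => hij (Fin.castSucc_injective _ h)) ..

theorem sub_map_sub (σ : Fin (m + 2 + 1) → Fin (m + 2 + 1)) (τ : Fin (m + 2) → Fin (m + 2))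
    {ρ : Fin (m + 2 + 1) → Fin (m + 2 + 1)} (h : ∀ i, ρ i.castSucc = σ (τ i).castSucc) (x : B) :
    sub σ (f (sub τ x)) = sub ρ (f x) := by
  rw [hf.map_sub, PolyadicAlgebra.sub_sub]
  refine hf.sub_congr x fun i => ?_
  rw [h i]
  exact congrArg σ (Fin.castSuccEmb.injective.extend_apply _ _ i)

theorem sub_eq_self {σ : Fin (m + 2 + 1) → Fin (m + 2 + 1)} {x : B} {j : Fin (m + 2)}
    (hx : cyl {j} x = x) (h : ∀ i : Fin (m + 2), i ≠ j → σ i.castSucc = i.castSucc) :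
    sub σ (f x) = f x := by
  rw [hf.sub_congr_of_cyl (τ := id) hx h, PolyadicAlgebra.sub_id]

/-- The composition of two elements of a neat reduct is in the neat reduct. -/
theorem exists_comp (x y : B) : ∃ z, f z = cyl {Fin.last (m + 2)}
    (sub (swap (Fin.castSucc 1) (Fin.last (m + 2))) (f x) ⊓
      sub (swap (Fin.castSucc 0) (Fin.last (m + 2))) (f y)) := by
  change _ ∈ Set.range f
  rw [hf.range_eq_last]
  exact PolyadicAlgebra.cyl_idem _ _

/-- The composition of two elements, with respect to the first two places. -/
noncomputable def comp (x y : B) : B := (hf.exists_comp x y).choose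

theorem map_comp (x y : B) : f (hf.comp x y) = cyl {Fin.last (m + 2)}
    (sub (swap (Fin.castSucc 1) (Fin.last (m + 2))) (f x) ⊓
      sub (swap (Fin.castSucc 0) (Fin.last (m + 2))) (f y)) :=
  (hf.exists_comp x y).choose_spec

theorem map_comp_inf (x y z : B) : f (hf.comp x y ⊓ z) = cyl {Fin.last (m + 2)}
    (f z ⊓ (sub (swap (Fin.castSucc 1) (Fin.last (m + 2))) (f x) ⊓
      sub (swap (Fin.castSucc 0) (Fin.last (m + 2))) (f y))) := by
  rw [hf.map_inf, hf.map_comp, inf_comm (f z), ← PolyadicAlgebra.cyl_inf_cyl_of_eq _ (hf.cyl_last z)]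

theorem comp_inf_eq_bot_iff (x y z : B) : hf.comp x y ⊓ z = ⊥ ↔
    f z ⊓ (sub (swap (Fin.castSucc 1) (Fin.last (m + 2))) (f x) ⊓
      sub (swap (Fin.castSucc 0) (Fin.last (m + 2))) (f y)) = ⊥ := by
  rw [← hf.map_eq_bot_iff, hf.map_comp_inf, PolyadicAlgebra.cyl_eq_bot_iff]

theorem sub_swap_zero_last {x : B} (hx : cyl {(1 : Fin (m + 2))} x = x) :
    sub (swap (Fin.castSucc 0) (Fin.last (m + 2))) (f x) =
      sub (swap (Fin.castSucc 1) (Fin.last (m + 2))) (f (sub (swap (0 : Fin (m + 2)) 1) x)) := by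
  rw [hf.sub_map_sub _ (swap (0 : Fin (m + 2)) 1) (ρ := swap (Fin.castSucc 1) (Fin.last (m + 2)) ∘
    swap (Fin.castSucc 0) (Fin.castSucc 1))]
  · refine hf.sub_congr_of_cyl hx fun i hi => ?_
    by_cases hi0 : i = 0
    · subst hi0
      simp
    · have h0 : i.castSucc ≠ Fin.castSucc 0 := fun h => hi0 (Fin.castSucc_injective _ h)
      have h1 : i.castSucc ≠ Fin.castSucc 1 := fun h => hi (Fin.castSucc_injective _ h)
      have h2 : i.castSucc ≠ Fin.last (m + 2) := Fin.castSucc_ne_last i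
      rw [Function.comp_apply, Equiv.swap_apply_of_ne_of_ne h0 h2, Equiv.swap_apply_of_ne_of_ne h0 h1,
        Equiv.swap_apply_of_ne_of_ne h1 h2]
  · intro i
    rw [Function.comp_apply, Fin.castSucc_injective _ |>.swap_apply]

/-- Read x between place 0 and the last place and y between the last place and place 1. From a at
place 0 one obtains b at the last place and then d at place 1. Since a, b and d depend on no place
1, they can be moved between places by substitutions. -/
theorem comp_inf_le {x y a b d : B} (ha : cyl {(1 : Fin (m + 2))} a = a)
    (hb : cyl {(1 : Fin (m + 2))} b = b)
    (hd : cyl {(1 : Fin (m + 2))} d = d) (hx : x ⊓ a ≤ sub (swap (0 : Fin (m + 2)) 1) b)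
    (hy : y ⊓ b ≤ sub (swap (0 : Fin (m + 2)) 1) d) :
    hf.comp x y ⊓ a ≤ sub (swap (0 : Fin (m + 2)) 1) d := by
  refine hf.le_of_map_le ?_
  rw [hf.map_comp_inf, ← hf.cyl_last (sub (swap (0 : Fin (m + 2)) 1) d)]
  refine PolyadicAlgebra.cyl_mono _ ?_
  have e1 : f a = sub (swap (Fin.castSucc 1) (Fin.last (m + 2))) (f a) := by
    refine (hf.sub_eq_self ha fun i hi => ?_).symm
    exact Equiv.swap_apply_of_ne_of_ne (fun h => hi (Fin.castSucc_injective _ h)) (Fin.castSucc_ne_last i)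
  have e2 : sub (swap (Fin.castSucc 0) (Fin.last (m + 2))) (f (sub (swap (0 : Fin (m + 2)) 1) d)) =
      f (sub (swap (0 : Fin (m + 2)) 1) d) := by
    rw [hf.sub_map_sub _ (swap (0 : Fin (m + 2)) 1) (ρ := swap (Fin.castSucc 0) (Fin.last (m + 2)) ∘
      swap (Fin.castSucc 0) (Fin.castSucc 1))]
    · rw [← PolyadicAlgebra.sub_id (ι := Fin (m + 2 + 1)) (f (sub (swap (0 : Fin (m + 2)) 1) d)),
        hf.sub_map_sub _ (swap (0 : Fin (m + 2)) 1) (ρ :=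
        swap (Fin.castSucc 0) (Fin.castSucc 1))]
      · refine hf.sub_congr_of_cyl hd fun i hi => ?_
        by_cases hi0 : i = 0
        · subst hi0
          rw [Function.comp_apply, Equiv.swap_apply_left, Equiv.swap_apply_of_ne_of_ne
            (fun h => zero_ne_one (Fin.castSucc_injective _ h).symm) (Fin.castSucc_ne_last _)]
        · have h0 : i.castSucc ≠ Fin.castSucc 0 := fun h => hi0 (Fin.castSucc_injective _ h)
          have h1 : i.castSucc ≠ Fin.castSucc 1 := fun h => hi (Fin.castSucc_injective _ h)
          rw [Function.comp_apply, Equiv.swap_apply_of_ne_of_ne h0 h1,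
            Equiv.swap_apply_of_ne_of_ne h0 (Fin.castSucc_ne_last i)]
      · intro i
        rw [id, Fin.castSucc_injective _ |>.swap_apply]
    · intro i
      rw [Function.comp_apply, Fin.castSucc_injective _ |>.swap_apply]
  calc f a ⊓ (sub (swap (Fin.castSucc 1) (Fin.last (m + 2))) (f x) ⊓
          sub (swap (Fin.castSucc 0) (Fin.last (m + 2))) (f y))
      ≤ sub (swap (Fin.castSucc 1) (Fin.last (m + 2))) (f (sub (swap (0 : Fin (m + 2)) 1) b)) ⊓
          sub (swap (Fin.castSucc 0) (Fin.last (m + 2))) (f y) := by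
        rw [← inf_assoc, e1, ← PolyadicAlgebra.sub_inf, inf_comm (f a), ← hf.map_inf]
        exact inf_le_inf_right _ (PolyadicAlgebra.sub_mono _ (hf.map_mono hx))
    _ = sub (swap (Fin.castSucc 0) (Fin.last (m + 2))) (f (y ⊓ b)) := by
        rw [← hf.sub_swap_zero_last hb, hf.map_inf, PolyadicAlgebra.sub_inf, inf_comm]
    _ ≤ sub (swap (Fin.castSucc 0) (Fin.last (m + 2))) (f (sub (swap (0 : Fin (m + 2)) 1) d)) :=
        PolyadicAlgebra.sub_mono _ (hf.map_mono hy)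
    _ = f (sub (swap (0 : Fin (m + 2)) 1) d) := e2

/-- Cylindrifying place 1 as well turns y into its domain, read at the last place. By hypothesis x
already implies this domain there, so what is left is a copy of x ⊓ a. -/
theorem comp_inf_ne_bot {x y a : B} (ha : cyl {(1 : Fin (m + 2))} a = a)
    (hx : x ≤ sub (swap (0 : Fin (m + 2)) 1) (cyl {(1 : Fin (m + 2))} y))
    (hxa : x ⊓ a ≠ ⊥) : hf.comp x y ⊓ a ≠ ⊥ := by
  rw [Ne, hf.comp_inf_eq_bot_iff, ← PolyadicAlgebra.cyl_eq_bot_iff {Fin.castSucc (1 : Fin (m + 2))}]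
  have e1 : f a = sub (swap (Fin.castSucc 1) (Fin.last (m + 2))) (f a) := by
    refine (hf.sub_eq_self ha fun i hi => ?_).symm
    exact Equiv.swap_apply_of_ne_of_ne (fun h => hi (Fin.castSucc_injective _ h)) (Fin.castSucc_ne_last i)
  have hU : cyl {Fin.castSucc (1 : Fin (m + 2))} (sub (swap (Fin.castSucc 1) (Fin.last (m + 2))) (f (x ⊓ a))) =
      sub (swap (Fin.castSucc 1) (Fin.last (m + 2))) (f (x ⊓ a)) := by
    rw [PolyadicAlgebra.cyl_sub _ _ _ (Equiv.injective _).injOn]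
    have : swap (Fin.castSucc 1) (Fin.last (m + 2)) ⁻¹' {Fin.castSucc 1} = {Fin.last (m + 2)} := by
      ext i
      rw [Set.mem_preimage, Set.mem_singleton_iff, Set.mem_singleton_iff, Equiv.swap_apply_eq_iff,
        Equiv.swap_apply_left]
    rw [this, hf.cyl_last]
  have hY : cyl {Fin.castSucc (1 : Fin (m + 2))} (sub (swap (Fin.castSucc 0) (Fin.last (m + 2))) (f y)) =
      sub (swap (Fin.castSucc 1) (Fin.last (m + 2))) (f (sub (swap (0 : Fin (m + 2)) 1) (cyl {(1 : Fin (m + 2))} y))) := by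
    rw [← hf.sub_swap_zero_last (PolyadicAlgebra.cyl_idem _ _),
      PolyadicAlgebra.cyl_sub _ _ _ (Equiv.injective _).injOn, hf.map_cyl]
    have h01 : (Fin.castSucc 1 : Fin (m + 2 + 1)) ≠ Fin.castSucc 0 := fun h =>
      zero_ne_one (Fin.castSucc_injective _ h).symm
    have : swap (Fin.castSucc 0) (Fin.last (m + 2)) ⁻¹' {Fin.castSucc 1} =
        (Fin.castSuccEmb : Fin (m + 2) ↪ Fin (m + 2 + 1)) '' {1} := by
      ext i
      rw [Set.mem_preimage, Set.mem_singleton_iff, Set.image_singleton, Set.mem_singleton_iff,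
        Equiv.swap_apply_eq_iff, Equiv.swap_apply_of_ne_of_ne h01 (Fin.castSucc_ne_last _)]
      rfl
    rw [this]
  rw [← inf_assoc, e1, ← PolyadicAlgebra.sub_inf, inf_comm (f a), ← hf.map_inf, ← hU, inf_comm,
    PolyadicAlgebra.cyl_inf_cyl, hY, hU,
    inf_eq_right.2 (PolyadicAlgebra.sub_mono _ (hf.map_mono (inf_le_left.trans hx))),
    PolyadicAlgebra.sub_swap_eq_bot_iff,
    hf.map_eq_bot_iff]
  exact hxa

/-- Interchanging place 1 with the last place swaps x and z as sides of the triangle and reverses y;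
a, living at place 0, is unaffected. -/
theorem comp_triangle {x y z a : B} (ha : cyl {(1 : Fin (m + 2))} a = a)
    (h : hf.comp x y ⊓ (z ⊓ a) ≠ ⊥) :
    hf.comp z (sub (swap (0 : Fin (m + 2)) 1) y) ⊓ (x ⊓ a) ≠ ⊥ := by
  rw [Ne, hf.comp_inf_eq_bot_iff] at h ⊢
  rw [← PolyadicAlgebra.sub_swap_eq_bot_iff (Fin.castSucc 1) (Fin.last (m + 2))] at h
  have e1 : sub (swap (Fin.castSucc 1) (Fin.last (m + 2))) (f a) = f a := by
    refine hf.sub_eq_self ha fun i hi => ?_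
    exact Equiv.swap_apply_of_ne_of_ne (fun h => hi (Fin.castSucc_injective _ h)) (Fin.castSucc_ne_last i)
  have e2 : sub (swap (Fin.castSucc 1) (Fin.last (m + 2)))
      (sub (swap (Fin.castSucc 0) (Fin.last (m + 2))) (f y)) =
      sub (swap (Fin.castSucc 0) (Fin.last (m + 2))) (f (sub (swap (0 : Fin (m + 2)) 1) y)) := by
    rw [PolyadicAlgebra.sub_sub,
      hf.sub_map_sub _ (swap (0 : Fin (m + 2)) 1) (ρ := swap (Fin.castSucc 0) (Fin.last (m + 2)) ∘
      swap (Fin.castSucc 0) (Fin.castSucc 1))]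
    · refine hf.sub_congr y fun i => ?_
      have h01 : (Fin.castSucc 1 : Fin (m + 2 + 1)) ≠ Fin.castSucc 0 := fun h =>
        zero_ne_one (Fin.castSucc_injective _ h).symm
      have h0 := Fin.castSucc_ne_last (0 : Fin (m + 2))
      have h1 := Fin.castSucc_ne_last (1 : Fin (m + 2))
      rw [Function.comp_apply, Function.comp_apply]
      by_cases hi0 : i = 0
      · rw [hi0, Equiv.swap_apply_left, Equiv.swap_apply_right, Equiv.swap_apply_left,
          Equiv.swap_apply_of_ne_of_ne h01 h1]
      · by_cases hi1 : i = 1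
        · rw [hi1, Equiv.swap_apply_of_ne_of_ne h01 h1, Equiv.swap_apply_left, Equiv.swap_apply_right,
            Equiv.swap_apply_left]
        · have h0' : i.castSucc ≠ Fin.castSucc 0 := fun h => hi0 (Fin.castSucc_injective _ h)
          have h1' : i.castSucc ≠ Fin.castSucc 1 := fun h => hi1 (Fin.castSucc_injective _ h)
          have h2 := Fin.castSucc_ne_last i
          rw [Equiv.swap_apply_of_ne_of_ne h0' h2, Equiv.swap_apply_of_ne_of_ne h0' h1',
            Equiv.swap_apply_of_ne_of_ne h1' h2, Equiv.swap_apply_of_ne_of_ne h0' h2]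
    · intro i
      rw [Function.comp_apply, Fin.castSucc_injective _ |>.swap_apply]
  rw [PolyadicAlgebra.sub_inf, PolyadicAlgebra.sub_inf, e2, PolyadicAlgebra.sub_swap_swap,
    hf.map_inf, PolyadicAlgebra.sub_inf, e1] at h
  rw [hf.map_inf]
  intro h'
  apply h
  rw [← h']
  ac_rfl

end IsNeatReductIso

/-! ### The failure of closure under composition -/

/-- The places other than the first two. -/
abbrev parameters {m : ℕ} (s : Fin (m + 2) → Point) : Fin m → Point :=
  s ∘ fun a => a.succ.succ

/-- The relation `the value of the first place lies in block i`, for points of sort `σ`. -/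
def blockSet (m : ℕ) (i : ℕ) (σ : Bool) : Set (Fin (m + 2) → Point) :=
  {s | Function.Injective (parameters s) ∧ s 0 ∉ Set.range (parameters s) ∧ (s 0).1 = σ ∧
    (Point.val (s 0) (parameters s)).1 = i}

/-- The relation `the first two places are of sorts σ and τ, their values lie in the same block and
have a difference in P`. -/
def differenceSet (m : ℕ) (σ τ : Bool) (P : Set ColorGroup) : Set (Fin (m + 2) → Point) :=
  {s | Function.Injective (parameters s) ∧ s 0 ∉ Set.range (parameters s) ∧
    s 1 ∉ Set.range (parameters s) ∧ (s 0).1 = σ ∧ (s 1).1 = τ ∧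
    (Point.val (s 0) (parameters s)).1 = (Point.val (s 1) (parameters s)).1 ∧
    (Point.val (s 0) (parameters s)).2 + (Point.val (s 1) (parameters s)).2 ∈ P}

/-! ### Supports of the block and difference relations, and moving a point to another block -/

section

variable {m : ℕ} {S : Type} {π : ColorGroup → S}

theorem Corr.of_imp {E : Set ℕ} {F : Set ColorGroup} {T : Set S} {X : Set (Fin (m + 2) → Point)}
    (h : ∀ s s', Sim m π π E F ((fun c => (c, c)) '' T) s s' → s' ∈ X → s ∈ X) :
    Corr m π π E F ((fun c => (c, c)) '' T) X X := fun s s' hs =>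
  ⟨h s' s hs.self_symm, h s s' hs⟩

theorem supports_blockSet (i : ℕ) (σ : Bool) : Supports m π {i} ∅ ∅ (blockSet m i σ) := by
  refine ⟨Set.finite_singleton _, Set.finite_empty, Set.finite_empty, Corr.of_imp ?_⟩
  rintro s s' h ⟨h1, h2, h3, h4⟩
  have hinj := h.comp_injective (fun _ => trivial) h1
  have h0 := (h.mem_range_iff (k := fun a : Fin m => a.succ.succ) (fun _ => trivial)
    (Set.mem_univ 0)).not.2 h2
  exact ⟨hinj, h0, (h.sort_eq 0 trivial).trans h3,
    ((h.matching _ (fun _ => trivial) hinj 0 trivial 0 trivial h0 h0).left i rfl).2 h4⟩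

theorem supports_differenceSet_same (σ : Bool) (g : ColorGroup) :
    Supports m π ∅ {g} ∅ (differenceSet m σ σ {g}) := by
  refine ⟨Set.finite_empty, Set.finite_singleton _, Set.finite_empty, Corr.of_imp ?_⟩
  rintro s s' h ⟨h1, h2, h3, h4, h5, h6, h7⟩
  have hinj := h.comp_injective (fun _ => trivial) h1
  have h0 := (h.mem_range_iff (k := fun a : Fin m => a.succ.succ) (fun _ => trivial)
    (Set.mem_univ 0)).not.2 h2
  have h0' := (h.mem_range_iff (k := fun a : Fin m => a.succ.succ) (fun _ => trivial)
    (Set.mem_univ 1)).not.2 h3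
  have e0 := (h.sort_eq 0 trivial).trans h4
  have e1 := (h.sort_eq 1 trivial).trans h5
  have := ((h.matching _ (fun _ => trivial) hinj 0 trivial 1 trivial h0 h0').same
    (e0.trans e1.symm) g rfl).2 ⟨h6, h7⟩
  exact ⟨hinj, h0, h0', e0, e1, this⟩

theorem supports_differenceSet_cross {σ τ : Bool} (hστ : σ ≠ τ) (c : S) :
    Supports m π ∅ ∅ {c} (differenceSet m σ τ (π ⁻¹' {c})) := by
  refine ⟨Set.finite_empty, Set.finite_empty, Set.finite_singleton _, Corr.of_imp ?_⟩
  rintro s s' h ⟨h1, h2, h3, h4, h5, h6, h7⟩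
  have hinj := h.comp_injective (fun _ => trivial) h1
  have h0 := (h.mem_range_iff (k := fun a : Fin m => a.succ.succ) (fun _ => trivial)
    (Set.mem_univ 0)).not.2 h2
  have h0' := (h.mem_range_iff (k := fun a : Fin m => a.succ.succ) (fun _ => trivial)
    (Set.mem_univ 1)).not.2 h3
  have e0 := (h.sort_eq 0 trivial).trans h4
  have e1 := (h.sort_eq 1 trivial).trans h5
  have := ((h.matching _ (fun _ => trivial) hinj 0 trivial 1 trivial h0 h0').cross
    (by rw [e0, e1]; exact hστ) _ ⟨c, rfl, rfl⟩).2 ⟨h6, h7⟩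
  exact ⟨hinj, h0, h0', e0, e1, this⟩

/-- A tuple of points, with the first two places interchanged. -/
theorem parameters_swap (s : Fin (m + 2) → Point) :
    parameters (s ∘ Equiv.swap 0 1) = parameters s := by
  funext a
  refine congrArg s (Equiv.swap_apply_of_ne_of_ne (Fin.succ_ne_zero _) fun h => ?_)
  exact Fin.succ_ne_zero a (Fin.succ_injective _ h)

theorem Point.exists_val_eq_const (D : Finset Point) (σ : Bool) (w : Fin m → Point)
    (hw : ∀ a, w a ∈ D) (v : Val) : ∃ u ∉ D, u.1 = σ ∧ Point.val u w = v := by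
  obtain ⟨u, hu, hσ, h⟩ := Point.exists_val_eq (m := m) D σ fun _ _ => v
  refine ⟨u, hu, hσ, h none (fun a => some (w a)) (by simp) (fun a y hy => ?_) (Or.inl rfl)⟩
  rw [← Option.some.inj hy]
  exact hw a

theorem exists_mem_differenceSet (i : ℕ) (g : ColorGroup) (σ : Bool) :
    ∃ s ∈ differenceSet m σ σ {g}, s ∈ blockSet m i σ := by
  classical
  let w : Fin m ↪ Point := Fin.valEmbedding.trans (Infinite.natEmbedding Point)
  let D : Finset Point := Finset.univ.image w
  have hw : ∀ a, w a ∈ D := fun a => Finset.mem_image_of_mem _ (Finset.mem_univ a)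
  obtain ⟨u, hu, huσ, huv⟩ := Point.exists_val_eq_const D σ w hw (i, 0)
  obtain ⟨u', hu', huσ', huv'⟩ := Point.exists_val_eq_const D σ w hw (i, g)
  have hr : ∀ x, x ∉ D → x ∉ Set.range w := by
    rintro _ hx ⟨a, rfl⟩
    exact hx (hw a)
  let s : Fin (m + 2) → Point := Fin.cons u (Fin.cons u' w)
  have hs : parameters s = w := rfl
  have hs0 : s 0 = u := rfl
  have hs1 : s 1 = u' := rfl
  refine ⟨s, ⟨?_, ?_, ?_, huσ, huσ', ?_, ?_⟩, ?_, ?_, huσ, ?_⟩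
  · rw [hs]; exact w.injective
  · rw [hs, hs0]; exact hr u hu
  · rw [hs, hs1]; exact hr u' hu'
  · rw [hs, hs0, hs1, huv, huv']
  · rw [hs, hs0, hs1, huv, huv']
    simp
  · rw [hs]; exact w.injective
  · rw [hs, hs0]; exact hr u hu
  · rw [hs, hs0, huv]

open Classical in
/-- A pair of values in the same block with a colour outside the support can be replaced by a pair
of values in different blocks. -/
theorem exists_sim_block_ne {E : Set ℕ} {F : Set ColorGroup} {T : Set S} (hE : E.Finite)
    {s : Fin (m + 2) → Point} (h0 : s 0 ∉ Set.range (parameters s)) (h01 : s 0 ≠ s 1)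
    (hi : (Point.val (s 0) (parameters s)).1 ∉ E)
    (hblock : (Point.val (s 0) (parameters s)).1 = (Point.val (s 1) (parameters s)).1)
    (hF : (s 0).1 = (s 1).1 →
      (Point.val (s 0) (parameters s)).2 + (Point.val (s 1) (parameters s)).2 ∉ F)
    (hT : (s 0).1 ≠ (s 1).1 →
      π ((Point.val (s 0) (parameters s)).2 + (Point.val (s 1) (parameters s)).2) ∉ T) :
    ∃ s', Sim m π π E F ((fun c => (c, c)) '' T) s s' ∧ parameters s' = parameters s ∧
      s' 0 ∉ Set.range (parameters s') ∧ (s' 0).1 = (s 0).1 ∧ s' 1 = s 1 ∧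
      (Point.val (s' 0) (parameters s')).1 ≠ (Point.val (s 0) (parameters s)).1 := by
  obtain ⟨i', hi'⟩ := (hE.union (Set.finite_singleton
    (Point.val (s 0) (parameters s)).1)).exists_notMem
  simp only [Set.mem_union, Set.mem_singleton_iff, not_or] at hi'
  let D : Finset Point := (Finset.univ.erase 0).image s
  -- The new point imitates the point at place 0 in every value except its own over the given
  -- parameters, where it is put into the new block.
  obtain ⟨u, hu, huσ, hval⟩ := Point.exists_val_eq (m := m) D (s 0).1 fun o b =>
    if o = none ∧ b = fun a => some (parameters s a) then (i', 0)
    else Point.val (o.getD (s 0)) fun a => (b a).getD (s 0)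
  let s' := Function.update s 0 u
  have hs0 : s' 0 = u := Function.update_self ..
  have hs : ∀ {p}, p ≠ 0 → s' p = s p := fun hp => Function.update_of_ne hp ..
  have hD : ∀ {p}, p ≠ 0 → s p ∈ D := fun hp =>
    Finset.mem_image_of_mem _ (Finset.mem_erase.2 ⟨hp, Finset.mem_univ _⟩)
  have hne' : ∀ {p}, p ≠ 0 → s p ≠ u := fun hp h => hu (h ▸ hD hp)
  have hcase : ∀ p : Fin (m + 2), p = 0 ∨ p = 1 ∨ ∃ a : Fin m, p = a.succ.succ := by
    intro p
    refine Fin.cases (Or.inl rfl) (fun q => ?_) p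
    refine Fin.cases (Or.inr (Or.inl rfl)) (fun a => Or.inr (Or.inr ⟨a, rfl⟩)) q
  have hne : ∀ {p}, p ≠ 0 → s p ≠ s 0 := by
    intro p hp
    rcases hcase p with rfl | rfl | ⟨a, rfl⟩
    · exact (hp rfl).elim
    · exact h01.symm
    · exact fun h => h0 ⟨a, h⟩
  have hpar : parameters s' = parameters s := funext fun a => hs (Fin.succ_ne_zero _)
  -- The values of the changed tuple: a single one differs from the original, even when the replaced
  -- point itself serves as a parameter.
  have hvs : ∀ (k : Fin m → Fin (m + 2)) (p : Fin (m + 2)), Point.val (s' p) (s' ∘ k) =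
      if p = 0 ∧ s ∘ k = parameters s then (i', 0) else Point.val (s p) (s ∘ k) := by
    intro k p
    let o : Fin (m + 2) → Option Point := fun p => if p = 0 then none else some (s p)
    have ho : ∀ p y, o p = some y → y ∈ D := by
      intro p y hy
      by_cases hp : p = 0
      · simp [o, hp] at hy
      · simp only [o, hp, if_false, Option.some.injEq] at hy
        exact hy ▸ hD hp
    have hou : ∀ p, (o p).getD u = s' p := by
      intro p
      by_cases hp : p = 0
      · simp [o, hp, hs0]
      · simp [o, hp, hs hp]
    have hos : ∀ p, (o p).getD (s 0) = s p := by
      intro p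
      by_cases hp : p = 0
      · simp [o, hp]
      · simp [o, hp]
    by_cases hz : p = 0 ∨ ∃ a, k a = 0
    · have := hval (o p) (o ∘ k) (ho p) (fun a => ho (k a)) (by
        rcases hz with rfl | ⟨a, ha⟩
        · exact Or.inl (by simp [o])
        · exact Or.inr ⟨a, by simp [o, ha]⟩)
      simp only [Function.comp_apply, hou, hos] at this
      refine this.trans (if_congr ?_ rfl rfl)
      refine and_congr (by simp [o]) ⟨fun h => funext fun a => ?_, fun h => funext fun a => ?_⟩
      · have h1 := congrFun h a
        rw [Function.comp_apply, ← hos, ← Function.comp_apply (f := o), h1]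
        rfl
      · have h1 := congrFun h a
        simp only [Function.comp_apply] at h1
        have h2 : k a ≠ 0 := fun hk => h0 ⟨a, by rw [← hk]; exact h1.symm⟩
        simp [o, h2, h1]
    · push Not at hz
      rw [if_neg fun h => hz.1 h.1, hs hz.1]
      congr 1
      exact funext fun a => hs (hz.2 a)
  refine ⟨s', ⟨?_, ?_, ?_⟩, hpar, ?_, ?_, hs (by simp), ?_⟩
  · intro p _ q _
    by_cases hp : p = 0
    · by_cases hq : q = 0
      · rw [hp, hq]; simp
      · rw [hp, hs0, hs hq]
        exact iff_of_false (hne hq).symm (hne' hq).symm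
    · by_cases hq : q = 0
      · rw [hq, hs0, hs hp]
        exact iff_of_false (hne hp) (hne' hp)
      · rw [hs hp, hs hq]
  · intro p _
    by_cases hp : p = 0
    · rw [hp, hs0, huσ]
    · rw [hs hp]
  · intro k _ _ p _ q _ hp hq
    rw [hvs, hvs]
    by_cases hk : s ∘ k = parameters s
    swap
    · rw [if_neg fun h => hk h.2, if_neg fun h => hk h.2]
      exact ColorMatched.refl
    rw [hk] at hp hq
    have key : ColorMatched π π E F ((fun c => (c, c)) '' T) (s 0).1 (s 1).1
        (Point.val (s 0) (parameters s)) (Point.val (s 1) (parameters s)) (i', 0)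
        (Point.val (s 1) (parameters s)) := by
      have hii' : i' ≠ (Point.val (s 1) (parameters s)).1 := hblock ▸ hi'.2
      refine ⟨fun e he => iff_of_false (fun h => hi (h ▸ he)) fun h : i' = e => hi'.1 (h ▸ he),
        fun _ _ => Iff.rfl, fun hs g hg => iff_of_false (fun h => hF hs (h.2 ▸ hg))
          fun h => hii' h.1, ?_⟩
      rintro hs _ ⟨c, hc, rfl⟩
      exact iff_of_false (fun h => hT hs (h.2 ▸ hc)) fun h => hii' h.1
    have h10 : (1 : Fin (m + 2)) ≠ 0 := by simp
    simp only [hk, and_true]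
    rcases hcase p with rfl | rfl | ⟨a, rfl⟩
    · rcases hcase q with rfl | rfl | ⟨b, rfl⟩
      · simp only [if_true]
        exact ColorMatched.diag fun e he =>
          iff_of_false (fun h => hi (h ▸ he)) fun h : i' = e => hi'.1 (h ▸ he)
      · simpa only [if_true, h10, if_false] using key
      · exact (hq ⟨b, rfl⟩).elim
    · rcases hcase q with rfl | rfl | ⟨b, rfl⟩
      · simpa only [if_true, h10, if_false] using ColorMatched.symm key
      · simp only [h10, if_false]
        exact ColorMatched.refl
      · exact (hq ⟨b, rfl⟩).elim
    · exact (hp ⟨a, rfl⟩).elim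
  · rw [hpar, hs0]
    rintro ⟨a, ha⟩
    exact hne' (Fin.succ_ne_zero _) ha
  · rw [hs0, huσ]
  · have := hvs (fun a => a.succ.succ) 0
    rw [if_pos ⟨rfl, rfl⟩] at this
    change (Point.val (s' 0) (parameters s')).1 ≠ _
    rw [this]
    exact hi'.2

end

/-! ### The algebra with countably many cross colours is not a neat reduct -/

section

open PolyadicAlgebra (sub cyl)

variable {m : ℕ} {S : Type} [Infinite S] {π : ColorGroup → S} (hπ : Function.Surjective π)

/-- `blockSet` as an element of the algebra of finitely supported relations. -/
def blockElement (m : ℕ) (i : ℕ) (σ : Bool) : (supportedAlgebra m π hπ).Carrier :=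
  ⟨blockSet m i σ, _, _, _, supports_blockSet i σ⟩

/-- The pairs of points of the first sort with difference `g`. -/
def sameElement (m : ℕ) (g : ColorGroup) : (supportedAlgebra m π hπ).Carrier :=
  ⟨differenceSet m false false {g}, _, _, _, supports_differenceSet_same false g⟩

/-- The pairs of points of different sorts with colour `c`. -/
def crossElement (m : ℕ) (c : S) : (supportedAlgebra m π hπ).Carrier :=
  ⟨differenceSet m false true (π ⁻¹' {c}), _, _, _, supports_differenceSet_cross (by simp) c⟩

theorem cyl_blockElement (i : ℕ) (σ : Bool) :
    cyl {(1 : Fin (m + 2))} (blockElement hπ m i σ) = blockElement hπ m i σ := by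
  refine Subtype.ext (Set.ext fun s => ⟨?_, fun hs => ⟨s, hs, fun _ _ => rfl⟩⟩)
  rintro ⟨t, ⟨h1, h2, h3, h4⟩, hst⟩
  have h0 : s 0 = t 0 := hst 0 (by simp)
  have hp : parameters s = parameters t := funext fun a => hst _ fun h =>
    Fin.succ_ne_zero a (Fin.succ_injective _ h)
  change Function.Injective (parameters s) ∧ s 0 ∉ Set.range (parameters s) ∧ (s 0).1 = σ ∧
    (Point.val (s 0) (parameters s)).1 = i
  rw [h0, hp]
  exact ⟨h1, h2, h3, h4⟩

theorem mem_sub_swap_blockElement {i : ℕ} {σ : Bool} {s : Fin (m + 2) → Point} :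
    s ∈ (sub (Equiv.swap (0 : Fin (m + 2)) 1) (blockElement hπ m i σ)).1 ↔
      Function.Injective (parameters s) ∧ s 1 ∉ Set.range (parameters s) ∧ (s 1).1 = σ ∧
        (Point.val (s 1) (parameters s)).1 = i := by
  rw [SetPEA.mem_sub]
  change Function.Injective (parameters (s ∘ Equiv.swap 0 1)) ∧ _ ∉ _ ∧ _ ↔ _
  rw [parameters_swap, Function.comp_apply, Equiv.swap_apply_left]

theorem differenceSet_inf_le {σ τ : Bool} {P : Set ColorGroup} {i : ℕ} {s : Fin (m + 2) → Point}
    (hs : s ∈ differenceSet m σ τ P) (hi : s ∈ blockSet m i σ) :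
    s ∈ (sub (Equiv.swap (0 : Fin (m + 2)) 1) (blockElement hπ m i τ)).1 := by
  obtain ⟨h1, -, h3, -, h5, h6, -⟩ := hs
  exact (mem_sub_swap_blockElement hπ).2 ⟨h1, h3, h5, h6 ▸ hi.2.2.2⟩

theorem sameElement_inf_le (g : ColorGroup) (i : ℕ) :
    sameElement hπ m g ⊓ blockElement hπ m i false ≤
      sub (Equiv.swap (0 : Fin (m + 2)) 1) (blockElement hπ m i false) :=
  fun _ hs => differenceSet_inf_le hπ hs.1 hs.2

theorem crossElement_inf_le (c : S) (i : ℕ) :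
    crossElement hπ m c ⊓ blockElement hπ m i false ≤
      sub (Equiv.swap (0 : Fin (m + 2)) 1) (blockElement hπ m i true) :=
  fun _ hs => differenceSet_inf_le hπ hs.1 hs.2

theorem sub_swap_crossElement_inf_le (c : S) (i : ℕ) :
    sub (Equiv.swap (0 : Fin (m + 2)) 1) (crossElement hπ m c) ⊓ blockElement hπ m i true ≤
      sub (Equiv.swap (0 : Fin (m + 2)) 1) (blockElement hπ m i false) := by
  rintro s ⟨⟨h1, h2, -, h4, -, h6, -⟩, -, -, -, hi⟩
  refine ⟨h1, h2, h4, ?_⟩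
  rw [parameters_swap] at h6 ⊢
  rw [h6, Function.comp_apply, Equiv.swap_apply_right]
  exact hi

/-- By genericity the second point has a partner of the other sort in its own block at any
prescribed difference. This is the domain condition needed for a nonzero composition. -/
theorem sameElement_le (g : ColorGroup) (c : S) :
    sameElement hπ m g ≤ sub (Equiv.swap (0 : Fin (m + 2)) 1)
      (cyl {(1 : Fin (m + 2))} (crossElement hπ m c)) := by
  classical
  rintro s ⟨h1, -, h3, -, h5, -, -⟩
  obtain ⟨h, rfl⟩ := hπ c
  let D : Finset Point := Finset.univ.image s
  obtain ⟨u, hu, huσ, huv⟩ := Point.exists_val_eq_const D true (parameters s)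
    (fun a => Finset.mem_image_of_mem _ (Finset.mem_univ _))
    ((Point.val (s 1) (parameters s)).1, (Point.val (s 1) (parameters s)).2 + h)
  let t := Function.update (s ∘ Equiv.swap (0 : Fin (m + 2)) 1) 1 u
  have ht : ∀ {p}, p ≠ 1 → t p = s (Equiv.swap 0 1 p) := fun hp => Function.update_of_ne hp ..
  have ht1 : t 1 = u := Function.update_self ..
  have ht0 : t 0 = s 1 := by
    rw [ht (by simp), Equiv.swap_apply_left]
  have hp : parameters t = parameters s := by
    rw [← parameters_swap s]
    exact funext fun a => ht fun h => Fin.succ_ne_zero a (Fin.succ_injective _ h)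
  refine ⟨t, ⟨?_, ?_, ?_, ?_, ?_, ?_, ?_⟩, fun i hi => (ht hi).symm⟩
  · rwa [hp]
  · rwa [hp, ht0]
  · rw [hp, ht1]
    rintro ⟨a, rfl⟩
    exact hu (Finset.mem_image_of_mem _ (Finset.mem_univ _))
  · rw [ht0, h5]
  · rw [ht1, huσ]
  · rw [hp, ht0, ht1, huv]
  · rw [hp, ht0, ht1, huv, Set.mem_preimage, ColorGroup.add_add_cancel]
    rfl

theorem sameElement_inf_ne_bot (g : ColorGroup) (i : ℕ) :
    sameElement hπ m g ⊓ blockElement hπ m i false ≠ ⊥ := by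
  intro h
  obtain ⟨s, h1, h2⟩ := exists_mem_differenceSet (m := m) i g false
  have : s ∈ (sameElement hπ m g ⊓ blockElement hπ m i false).1 := ⟨h1, h2⟩
  rw [h] at this
  exact this

theorem exists_mem_of_ne_bot {X : (supportedAlgebra m π hπ).Carrier} (hX : X ≠ ⊥) :
    ∃ s, s ∈ X.1 := by
  by_contra h
  push Not at h
  exact hX (Subtype.ext (Set.eq_empty_of_forall_notMem h))

/-- An element with finite support that forces equality of blocks contains, outside of its
support, only pairs with a colour in its support. -/
theorem colour_mem_support {X : (supportedAlgebra m π hπ).Carrier} {E : Set ℕ} {F : Set ColorGroup}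
    {T : Set S} (hX : Supports m π E F T X.1) {τ : Bool}
    (hblock : ∀ i, X ⊓ blockElement hπ m i false ≤
      sub (Equiv.swap (0 : Fin (m + 2)) 1) (blockElement hπ m i τ))
    {s : Fin (m + 2) → Point} {i : ℕ} (hs : s ∈ X.1) (hsi : s ∈ blockSet m i false) (hi : i ∉ E)
    (h01 : s 0 ≠ s 1) :
    ((s 0).1 = (s 1).1 ∧
      (Point.val (s 0) (parameters s)).2 + (Point.val (s 1) (parameters s)).2 ∈ F) ∨
    ((s 0).1 ≠ (s 1).1 ∧
      π ((Point.val (s 0) (parameters s)).2 + (Point.val (s 1) (parameters s)).2) ∈ T) := by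
  by_contra hcon
  rw [not_or, not_and, not_and] at hcon
  obtain ⟨h1, h2, h3, rfl⟩ := hsi
  have hb := (mem_sub_swap_blockElement hπ).1 (hblock _ ⟨hs, h1, h2, h3, rfl⟩)
  -- Otherwise the first point could move to another block without leaving X, while the second
  -- stays, against the forced equality of blocks.
  obtain ⟨s', hss', hpar, h0', hσ', hs1, hne⟩ := exists_sim_block_ne (π := π) (T := T)
    hX.finite_index h2 h01 hi hb.2.2.2.symm hcon.1 hcon.2
  have hs' := (hX.corr s s' hss').1 hs
  have hb' := (mem_sub_swap_blockElement hπ).1 (hblock (Point.val (s' 0) (parameters s')).1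
    ⟨hs', by rwa [hpar], h0', hσ'.trans h3, rfl⟩)
  apply hne
  rw [← hb'.2.2.2, hs1, hpar, hb.2.2.2]

/-- A pigeonhole argument on triangles of colours. The dilation is an arbitrary polyadic algebra
whose additional place has no concrete meaning, so only the three laws of composition can be used;
block elements, which constrain a single place, carry the information through it. -/
theorem not_inNrPA_supportedAlgebra [Countable S] :
    ¬ InNrPA.{u} (Fin.castSuccEmb : Fin (m + 2) ↪ Fin (m + 2 + 1))
      (supportedAlgebra m π hπ).Carrier := by
  rintro ⟨C, hC, hC', f, hf⟩
  have hcyl := fun i σ => cyl_blockElement (m := m) hπ i σ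
  let y := crossElement hπ m (π 0)
  have hw1 : ∀ g i, hf.comp (sameElement hπ m g) y ⊓ blockElement hπ m i false ≤
      sub (Equiv.swap (0 : Fin (m + 2)) 1) (blockElement hπ m i true) := fun g i =>
    hf.comp_inf_le (hcyl i false) (hcyl i false) (hcyl i true) (sameElement_inf_le hπ g i)
      (crossElement_inf_le hπ _ i)
  have hw2 : ∀ g i, hf.comp (sameElement hπ m g) y ⊓ blockElement hπ m i false ≠ ⊥ := fun g i =>
    hf.comp_inf_ne_bot (hcyl i false) (sameElement_le hπ g _) (sameElement_inf_ne_bot hπ g i)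
  have hcol : ∀ g, ∃ c, {i | hf.comp (sameElement hπ m g) y ⊓
      (crossElement hπ m c ⊓ blockElement hπ m i false) ≠ ⊥}.Infinite := by
    intro g
    obtain ⟨E, F, T, hX⟩ := (hf.comp (sameElement hπ m g) y).2
    by_contra hfin
    simp only [not_exists, Set.not_infinite] at hfin
    -- Each block outside E shows a cross colour from the finite set T. If every colour occurred in
    -- finitely many blocks only, there would be finitely many such blocks.
    refine hX.finite_index.infinite_compl
      ((hX.finite_cross.biUnion fun c _ => hfin c).subset fun i hi => ?_)
    obtain ⟨s, hs, hsi⟩ := exists_mem_of_ne_bot hπ (hw2 g i)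
    have hb := (mem_sub_swap_blockElement hπ).1 (hw1 g i ⟨hs, hsi⟩)
    obtain ⟨h1, h2, h3, h4⟩ := hsi
    have hsort : (s 0).1 ≠ (s 1).1 := by
      rw [h3, hb.2.2.1]
      simp
    rcases colour_mem_support hπ hX (hw1 g) hs ⟨h1, h2, h3, h4⟩ hi (fun h => hsort (h ▸ rfl)) with
      h | h
    · exact (hsort h.1).elim
    · refine Set.mem_biUnion h.2 fun hbot => ?_
      have : s ∈ (⊥ : (supportedAlgebra m π hπ).Carrier).1 := by
        rw [← hbot]
        exact ⟨hs, ⟨h1, h2, hb.2.1, h3, hb.2.2.1, h4.trans hb.2.2.2.symm, rfl⟩, h1, h2, h3, h4⟩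
      exact this
  choose c hc using hcol
  -- Uncountably many g are distributed over countably many cross colours.
  obtain ⟨d, hd⟩ : ∃ d, (c ⁻¹' {d}).Infinite := by
    by_contra hfin
    simp only [not_exists, Set.not_infinite] at hfin
    have hcount : (⋃ d, c ⁻¹' {d}).Countable := Set.countable_iUnion fun d => (hfin d).countable
    rw [← Set.preimage_iUnion, Set.iUnion_of_singleton, Set.preimage_univ,
      Set.countable_univ_iff] at hcount
    exact not_countable hcount
  have hv1 : ∀ i, hf.comp (crossElement hπ m d) (sub (Equiv.swap (0 : Fin (m + 2)) 1) y) ⊓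
      blockElement hπ m i false ≤
      sub (Equiv.swap (0 : Fin (m + 2)) 1) (blockElement hπ m i false) := fun i =>
    hf.comp_inf_le (hcyl i false) (hcyl i true) (hcyl i false) (crossElement_inf_le hπ _ i)
      (sub_swap_crossElement_inf_le hπ _ i)
  obtain ⟨E, F, T, hX⟩ := (hf.comp (crossElement hπ m d)
    (sub (Equiv.swap (0 : Fin (m + 2)) 1) y)).2
  -- Excluding g = 0 ensures that two points with difference g are distinct.
  obtain ⟨g, hg, hgF⟩ := hd.exists_notMem_finite (hX.finite_same.insert 0)
  obtain ⟨i, hi, hiE⟩ := (hc g).exists_notMem_finite hX.finite_index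
  rw [show c g = d from hg] at hi
  obtain ⟨s, hs, ⟨h1, h2, h3, h4, h5, h6, h7⟩, hsi⟩ :=
    exists_mem_of_ne_bot hπ (hf.comp_triangle (hcyl i false) hi)
  have h01 : s 0 ≠ s 1 := by
    intro h
    rw [← h, ColorGroup.add_self] at h7
    exact hgF (Set.mem_insert_iff.2 (Or.inl (Set.mem_singleton_iff.1 h7).symm))
  rcases colour_mem_support hπ hX hv1 hs hsi hiE h01 with h | h
  · rw [Set.mem_singleton_iff.1 h7] at h
    exact hgF (Set.mem_insert_of_mem _ h.2)
  · exact h.1 (h4.trans h5.symm)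

end

/-! ### The two algebras and the theorem -/

/-- The difference relations of distinct g are nonempty and disjoint, and there are uncountably many
g. -/
theorem uncountable_supportedAlgebra (m : ℕ) {S : Type} [Infinite S] {π : ColorGroup → S}
    (hπ : Function.Surjective π) : Uncountable (supportedAlgebra m π hπ).Carrier := by
  refine Function.Injective.uncountable (f := sameElement hπ m) fun g g' h => ?_
  obtain ⟨s, hs, -⟩ := exists_mem_differenceSet (m := m) 0 g false
  have hs' : s ∈ (sameElement hπ m g').1 := by
    rw [← h]
    exact hs
  exact hs.2.2.2.2.2.2.symm.trans hs'.2.2.2.2.2.2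

theorem ColorGroup.exists_surjective_nat : ∃ f : ColorGroup → ℕ, Function.Surjective f :=
  ⟨_, Function.invFun_surjective (Infinite.natEmbedding ColorGroup).injective⟩

theorem mainTheorem2 (n : ℕ) (hn : 1 < n) :
    ∃ (A B : Type) (_ : BooleanAlgebra A) (_ : BooleanAlgebra B)
      (_ : PolyadicEqualityAlgebra (Fin n) A) (_ : PolyadicEqualityAlgebra (Fin n) B),
      -- both algebras are atomic
      IsAtomic A ∧ IsAtomic B ∧
      -- `A` is an uncountable algebra of `n`-ary relations on an uncountable set
      Uncountable A ∧
      (∃ U : Type, Uncountable U ∧ Nonempty (A ↪[peaLanguage (Fin n)] Set (Fin n → U))) ∧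
      -- `A` is the neat reduct of an `ω`-dimensional algebra, and the same with equality
      InNrPA.{0} (Fin.valEmbedding : Fin n ↪ ℕ) A ∧
      InNrPEA.{0} (Fin.valEmbedding : Fin n ↪ ℕ) A ∧
      -- `B` is not the neat reduct of an `(n+1)`-dimensional algebra
      ¬ InNrPA.{u} (Fin.castSuccEmb : Fin n ↪ Fin (n + 1)) B ∧
      -- the second player has a winning strategy in `EF_ω(A, B)`
      HasWinningStrategy (Fin n) A B ∧
      -- the algebras, and their atom structures, are `L_{∞,ω}`-equivalent
      InfEquiv (peaLanguage (Fin n)) A B ∧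
      InfEquiv (atomLanguage (Fin n)) (Atoms A) (Atoms B) := by
  obtain ⟨m, rfl⟩ : ∃ m, n = m + 2 := ⟨n - 2, by omega⟩
  obtain ⟨π, hπ⟩ := ColorGroup.exists_surjective_nat
  have hid := Function.surjective_id (α := ColorGroup)
  have hS := backAndForth_corrSystem (m := m) hid hπ
  have hne := corrSystem_nonempty (m := m) hid hπ
  exact ⟨(supportedAlgebra m id hid).Carrier, (supportedAlgebra m π hπ).Carrier, inferInstance,
    inferInstance, inferInstance, inferInstance, isAtomic_supportedAlgebra hid,
    isAtomic_supportedAlgebra hπ, uncountable_supportedAlgebra m hid,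
    ⟨Point, inferInstance, ⟨(supportedAlgebra m id hid).inclusion⟩⟩,
    (inNrPEA_supportedAlgebra m).inNrPA, inNrPEA_supportedAlgebra m,
    not_inNrPA_supportedAlgebra hπ, hS.hasWinningStrategy hne, hS.infEquiv hne,
    hS.atoms.infEquiv (hne.image _)⟩
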